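/- Let $a<b$, $k>0$, $1<\beta\le 2$ with $k<\beta\le 2k$, and let $\gamma,\rho,\omega>0$ be real. For real $x$ and $k,\alpha,\delta>0$ put $$\Gamma_k(\delta)=\int_0^\infty t^{\delta-1}e^{-t^k/k}\,dt,\qquad (x)_{n,k}=x(x+k)\cdots(x+(n-1)k),\qquad E^{x}_{k,\alpha,\delta}(z)=\sum_{n=0}^\infty\frac{(x)_{n,k}\,z^n}{\Gamma_k(\alpha n+\delta)\,n!}.$$ The $k$-Prabhakar integral of order $\delta>0$ is $$({}_k\mathbf P^{x}_{\rho,\delta,\omega,a+}f)(t)=\int_a^t\frac{(t-u)^{\delta/k-1}}{k}\,E^{x}_{k,\rho,\delta}\big(\omega(t-u)^{\rho/k}\big)f(u)\,du,$$ and the $k$-Prabhakar derivative is $$({}_k\mathbf D^{\gamma}_{\rho,\beta,\omega,a+}f)(t)=\Big(\frac{d}{dt}\Big)^{m}k^{m}\,({}_k\mathbf P^{-\gamma}_{\rho,mk-\beta,\omega,a+}f)(t),\qquad m=\lfloor\beta/k\rfloor+1,$$ which is said to exist on $(a,b)$ if ${}_k\mathbf P^{-\gamma}_{\rho,mk-\beta,\omega,a+}f$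 is $m$ times differentiable at every point of $(a,b)$. Let $q$ be a real function that is continuous and integrable on $(a,b)$ (for instance, continuous on $[a,b]$), and let $y\in C[a,b]$ be real-valued. Then $y$ is a solution of the boundary value problem $$({}_k\mathbf D^{\gamma}_{\rho,\beta,\omega,a+}y)(t)+q(t)y(t)=0\quad(a<t<b),\qquad y(a)=y(b)=0$$ (including that the derivative exists on $(a,b)$) if and only if $$y(t)=\int_a^b G(t,u)\,q(u)\,y(u)\,du\qquad\text{for all }t\in[a,b],$$ where $$G(t,u)=\frac{(t-a)^{\beta/k-1}E^\gamma_{k,\rho,\beta}(\omega(t-a)^{\rho/k})}{(b-a)^{\beta/k-1}E^\gamma_{k,\rho,\beta}(\omega(b-a)^{\rho/k})}\cdot\frac{(b-u)^{\beta/k-1}}{k}E^\gamma_{k,\rho,\beta}(\omega(b-u)^{\rho/k})-\frac{(t-u)^{\beta/k-1}}{k}E^\gamma_{k,\rho,\beta}(\omega(t-u)^{\rho/k})$$ for $a\le u\le t\le b$, and $$G(t,u)=\frac{(t-a)^{\beta/k-1}E^\gamma_{k,\rho,\beta}(\omega(t-a)^{\rho/k})}{(b-a)^{\beta/k-1}E^\gamma_{k,\rho,\beta}(\omega(b-a)^{\rho/k})}\cdot\frac{(b-u)^{\beta/k-1}}{k}E^\gamma_{k,\rho,\beta}(\omega(b-u)^{\rho/k})$$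 for $a\le t\le u\le b$. -/

import Mathlib

open Set MeasureTheory

noncomputable section

namespace KPrabhakar

/-- The `k`-Gamma function `Γ_k(x) = ∫_0^∞ t^(x-1) exp(-t^k / k) dt`, for `k > 0` and `x > 0`. -/
def kGamma (k x : ℝ) : ℝ :=
  ∫ t in Ioi (0 : ℝ), t ^ (x - 1) * Real.exp (-(t ^ k / k))

/-- The Pochhammer `k`-symbol `(x)_{n,k} = x (x + k) ⋯ (x + (n-1) k)`.  It equals
`Γ_k(x + n k) / Γ_k(x)` away from the poles of `Γ_k`, and it is the continuous extension of that
quotient to all real `x`. -/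
def kPochhammer (k x : ℝ) (n : ℕ) : ℝ :=
  ∏ i ∈ Finset.range n, (x + i * k)

/-- The `k`-Mittag-Leffler function
`E^γ_{k,α,β}(z) = ∑_{n ≥ 0} (γ)_{n,k} z^n / (Γ_k(α n + β) n!)`, for `k, α, β > 0`; the series then
converges for every `z`. -/
def kMittagLeffler (k α β γ z : ℝ) : ℝ :=
  ∑' n : ℕ, kPochhammer k γ n * z ^ n / (kGamma k (α * n + β) * (n.factorial : ℝ))

/-- The `k`-Prabhakar integral with base point `a`, of order `β > 0`:
`(ₖP^γ_{ρ,β,ω,a+} φ)(t) = ∫_a^t (t-u)^(β/k-1) / k * E^γ_{k,ρ,β}(ω (t-u)^(ρ/k)) φ(u) du`. -/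
def kPrabhakarIntegral (k ρ β ω γ a : ℝ) (φ : ℝ → ℝ) (t : ℝ) : ℝ :=
  ∫ u in a..t, (t - u) ^ (β / k - 1) / k
    * kMittagLeffler k ρ β γ (ω * (t - u) ^ (ρ / k)) * φ u

/-- The number `m = [β/k] + 1` of differentiations in the `k`-Prabhakar derivative. -/
def kOrder (k β : ℝ) : ℕ := ⌊β / k⌋₊ + 1

/-- The function `ₖP^{-γ}_{ρ,mk-β,ω,a+} f`, with `m = [β/k] + 1`, whose `m`-th derivative is taken
in the definition of the `k`-Prabhakar derivative. -/
def kPrabhakarPrimitive (k ρ β ω γ a : ℝ) (f : ℝ → ℝ) : ℝ → ℝ :=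
  kPrabhakarIntegral k ρ (kOrder k β * k - β) ω (-γ) a f

/-- The `k`-Prabhakar derivative
`(ₖD^γ_{ρ,β,ω,a+} f)(t) = (d/dt)^m k^m (ₖP^{-γ}_{ρ,mk-β,ω,a+} f)(t)`, `m = [β/k] + 1`. -/
def kPrabhakarDeriv (k ρ β ω γ a : ℝ) (f : ℝ → ℝ) (t : ℝ) : ℝ :=
  iteratedDeriv (kOrder k β)
    (fun s => k ^ kOrder k β * kPrabhakarPrimitive k ρ β ω γ a f s) t

/-- The `k`-Prabhakar derivative of `f` exists at every point of `(a, b)`: the function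
`ₖP^{-γ}_{ρ,mk-β,ω,a+} f` is `m` times differentiable there. -/
def KPrabhakarDifferentiableOn (k ρ β ω γ a b : ℝ) (f : ℝ → ℝ) : Prop :=
  ∀ j < kOrder k β,
    DifferentiableOn ℝ (iteratedDeriv j (kPrabhakarPrimitive k ρ β ω γ a f)) (Ioo a b)

/-- `y` solves the boundary value problem
`(ₖD^γ_{ρ,β,ω,a+} y)(t) + q(t) y(t) = 0` for `a < t < b`, `y(a) = y(b) = 0`. -/
structure IsBVPSolution (k ρ β ω γ a b : ℝ) (q y : ℝ → ℝ) : Prop where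
  differentiable : KPrabhakarDifferentiableOn k ρ β ω γ a b y
  equation : ∀ t ∈ Ioo a b, kPrabhakarDeriv k ρ β ω γ a y t + q t * y t = 0
  left : y a = 0
  right : y b = 0

/-- The Green's function of the boundary value problem. -/
def green (k ρ β ω γ a b t u : ℝ) : ℝ :=
  if u ≤ t then
    ((t - a) ^ (β / k - 1) * kMittagLeffler k ρ β γ (ω * (t - a) ^ (ρ / k)))
        / ((b - a) ^ (β / k - 1) * kMittagLeffler k ρ β γ (ω * (b - a) ^ (ρ / k)))
        * ((b - u) ^ (β / k - 1) / k) * kMittagLeffler k ρ β γ (ω * (b - u) ^ (ρ / k))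
      - (t - u) ^ (β / k - 1) / k * kMittagLeffler k ρ β γ (ω * (t - u) ^ (ρ / k))
  else
    ((t - a) ^ (β / k - 1) * kMittagLeffler k ρ β γ (ω * (t - a) ^ (ρ / k)))
        / ((b - a) ^ (β / k - 1) * kMittagLeffler k ρ β γ (ω * (b - a) ^ (ρ / k)))
        * ((b - u) ^ (β / k - 1) / k) * kMittagLeffler k ρ β γ (ω * (b - u) ^ (ρ / k))

end KPrabhakar

end

noncomputable section
namespace KPrabhakar

open Filter Topology Convolution Asymptotics
open ContinuousLinearMap (mul)

/-! Let `A` be the Prabhakar kernel of order `β` and parameter `γ`, let `B` be the one of order `mk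
- β` and parameter `-γ`, and put `h = q y`. Prabhakar kernels form a semigroup under convolution:
orders and parameters add (`conv_prabhakarKernel`). So `A * B` has order `mk` and parameter `0`,
which makes it `k⁻ᵐ` times the kernel of the `m`-fold integral `Iᵐ`
(`isInversePair_prabhakarKernel`). The derivative in the equation is the `m`-th derivative of `kᵐ B
* y`.

If `y = c A(· - a) - A * h`, convolving with `B` gives `kᵐ B * y = c (t - a)^(m-1)/(m-1)! - Iᵐ h`.
Differentiating `m` times leaves `-h` (`derivative_solution`). The value at `a` is `0` because `A 0
= 0`, and the value at `b` is `0` for exactly one `c`, because `A (b - a) > 0`. Substituting this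
`c` yields Green's function (`integral_green`).

Conversely, for a solution `y`, the function `kᵐ B * y + Iᵐ h` has vanishing `m`-th derivative, so
it is a polynomial in `t - a` of degree less than `m`. Since `y` is continuous with `y a = 0`, and
`β ≤ 2k`, this function is `o((t - a)^(m-2))` at `a`, so only the monomial of degree `m - 1`
survives. Hence `B * w = 0` for `w = y - c A(· - a) + A * h`. Convolving with `A` gives `Iᵐ w = 0`,
so `w = 0` (`exists_eq_solution`). -/

/-- The convolution of `K` and `f` over `[a, t]`. -/
def conv (a : ℝ) (K f : ℝ → ℝ) (t : ℝ) : ℝ :=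
  ∫ u in a..t, K (t - u) * f u

/-- The kernel of the `k`-Riemann-Liouville integral of order `p`. -/
def powKernel (k p s : ℝ) : ℝ :=
  s ^ (p / k - 1) / (k * kGamma k p)

/-- The kernel of the `k`-Prabhakar integral of order `δ`. -/
def prabhakarKernel (k ρ ω δ x s : ℝ) : ℝ :=
  s ^ (δ / k - 1) / k * kMittagLeffler k ρ δ x (ω * s ^ (ρ / k))

/-- The coefficients of the expansion of the `k`-Prabhakar kernel in power kernels. -/
def prabhakarCoeff (k ω x : ℝ) (n : ℕ) : ℝ :=
  kPochhammer k x n * ω ^ n / n.factorial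

theorem kPrabhakarIntegral_eq_conv (k ρ δ ω x a : ℝ) (f : ℝ → ℝ) :
    kPrabhakarIntegral k ρ δ ω x a f = conv a (prabhakarKernel k ρ ω δ x) f := rfl

/-! ### The `k`-Gamma function -/

theorem kGamma_eq {k x : ℝ} (hk : 0 < k) (hx : 0 < x) :
    kGamma k x = k ^ (x / k - 1) * Real.Gamma (x / k) := by
  have h := integral_rpow_mul_exp_neg_mul_rpow (p := k) (q := x - 1) (b := k⁻¹) hk
    (by linarith) (by positivity)
  have h2 : kGamma k x = ∫ t in Ioi (0 : ℝ), t ^ (x - 1) * Real.exp (-k⁻¹ * t ^ k) := by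
    unfold kGamma
    congr 1
    ext t
    congr 2
    ring
  rw [h2, h, sub_add_cancel, Real.inv_rpow hk.le, ← Real.rpow_neg hk.le, Real.rpow_sub_one hk.ne']
  congr 1
  rw [neg_div, neg_neg]
  ring

theorem kGamma_pos {k x : ℝ} (hk : 0 < k) (hx : 0 < x) : 0 < kGamma k x := by
  rw [kGamma_eq hk hx]
  have := Real.Gamma_pos_of_pos (div_pos hx hk)
  positivity

/-- Keep only the part `t > R` of Euler's integral, where `t ^ (x - 1) ≥ R ^ (x - 1)`. As `R` is
arbitrary, `Γ` outgrows every exponential; this is all that convergence of the Mittag-Leffler series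
needs. -/
theorem Gamma_ge {R x : ℝ} (hR : 0 < R) (hx : 1 ≤ x) :
    R ^ (x - 1) * Real.exp (-R) ≤ Real.Gamma x := by
  rw [Real.Gamma_eq_integral (by linarith), ← integral_exp_neg_Ioi R, ← integral_const_mul]
  have hi := Real.GammaIntegral_convergent (show 0 < x by linarith)
  calc _ ≤ ∫ t in Ioi R, Real.exp (-t) * t ^ (x - 1) := by
        refine setIntegral_mono_on ((integrableOn_exp_neg_Ioi R).const_mul _)
          (hi.mono_set (Ioi_subset_Ioi hR.le)) measurableSet_Ioi fun t ht => ?_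
        rw [mul_comm]
        gcongr
        exact le_of_lt ht
    _ ≤ _ := by
        refine setIntegral_mono_set hi ?_ (Ioi_subset_Ioi hR.le).eventuallyLE
        filter_upwards [ae_restrict_mem measurableSet_Ioi] with t ht
        have : (0 : ℝ) < t := ht
        positivity

theorem kGamma_ge {k S x : ℝ} (hk : 0 < k) (hS : 0 < S) (hx : k ≤ x) :
    S ^ (x / k - 1) * Real.exp (-(S / k)) ≤ kGamma k x := by
  rw [kGamma_eq hk (by linarith)]
  have h := Gamma_ge (div_pos hS hk) ((one_le_div hk).2 hx)
  calc _ = k ^ (x / k - 1) * ((S / k) ^ (x / k - 1) * Real.exp (-(S / k))) := by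
        rw [← mul_assoc, ← Real.mul_rpow hk.le (by positivity), mul_div_cancel₀ _ hk.ne']
    _ ≤ _ := by gcongr

theorem kGamma_natCast_succ_mul {k : ℝ} (hk : 0 < k) (m : ℕ) :
    kGamma k (((m + 1 : ℕ) : ℝ) * k) = k ^ m * m.factorial := by
  rw [kGamma_eq hk (by positivity), mul_div_cancel_right₀ _ hk.ne']
  push_cast
  rw [Real.Gamma_nat_eq_factorial, add_sub_cancel_right, Real.rpow_natCast]

/-! ### The Pochhammer `k`-symbol -/

theorem kPochhammer_succ (k x : ℝ) (n : ℕ) :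
    kPochhammer k x (n + 1) = kPochhammer k x n * (x + n * k) := by
  simp [kPochhammer, Finset.prod_range_succ]

theorem kPochhammer_pos {k x : ℝ} (hk : 0 < k) (hx : 0 < x) (n : ℕ) : 0 < kPochhammer k x n :=
  Finset.prod_pos fun i _ => by positivity

theorem kPochhammer_nonneg {k x : ℝ} (hk : 0 < k) (hx : 0 ≤ x) (n : ℕ) : 0 ≤ kPochhammer k x n :=
  Finset.prod_nonneg fun i _ => by positivity

theorem abs_kPochhammer_le {k : ℝ} (hk : 0 < k) (x : ℝ) (n : ℕ) :
    |kPochhammer k x n| ≤ kPochhammer k |x| n := by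
  unfold kPochhammer
  rw [Finset.abs_prod]
  refine Finset.prod_le_prod (fun _ _ => abs_nonneg _) fun i _ => ?_
  refine (abs_add_le _ _).trans ?_
  rw [abs_of_nonneg (show 0 ≤ (i : ℝ) * k by positivity)]

theorem kPochhammer_le {k x : ℝ} (hk : 0 < k) (hx : 0 ≤ x) (n : ℕ) :
    kPochhammer k x n ≤ n.factorial * (x + k) ^ n := by
  induction n with
  | zero => simp [kPochhammer]
  | succ n ih =>
    rw [kPochhammer_succ, Nat.factorial_succ, pow_succ]
    push_cast
    calc kPochhammer k x n * (x + n * k)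
        ≤ (n.factorial * (x + k) ^ n) * ((n + 1) * (x + k)) := by
          gcongr
          nlinarith [show (0 : ℝ) ≤ n * x by positivity]
      _ = _ := by ring

theorem kPochhammer_zero_succ (k : ℝ) (n : ℕ) : kPochhammer k 0 (n + 1) = 0 :=
  Finset.prod_eq_zero (Finset.mem_range.2 n.succ_pos) (by simp)

open Finset in
/-- The Chu-Vandermonde identity. -/
theorem kPochhammer_add (k x y : ℝ) (n : ℕ) :
    ∑ ij ∈ antidiagonal n, (n.choose ij.1 : ℝ) * (kPochhammer k x ij.1 * kPochhammer k y ij.2) =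
      kPochhammer k (x + y) n := by
  induction n with
  | zero => simp [kPochhammer]
  | succ n ih =>
    rw [sum_antidiagonal_choose_succ_mul (fun i j => kPochhammer k x i * kPochhammer k y j),
      kPochhammer_succ, ← ih, ← sum_add_distrib, sum_mul]
    -- Pascal's rule has split the sum. With `i + j = n` the two new factors add up to `(x + i k) +
    -- (y + j k) = x + y + n k`.
    refine sum_congr rfl fun ij hij => ?_
    have h : ij.1 + ij.2 = n := mem_antidiagonal.1 hij
    rw [kPochhammer_succ, kPochhammer_succ, ← Nat.choose_symm_of_eq_add h.symm, ← h]
    push_cast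
    ring

open Finset in
-- Formally the coefficients generate `(1 - k ω z) ^ (-x / k)`, so Cauchy products add the
-- parameters `x` and `y`.
theorem prabhakarCoeff_add (k ω x y : ℝ) (n : ℕ) :
    ∑ ij ∈ antidiagonal n, prabhakarCoeff k ω x ij.1 * prabhakarCoeff k ω y ij.2 =
      prabhakarCoeff k ω (x + y) n := by
  unfold prabhakarCoeff
  rw [← kPochhammer_add, sum_mul, sum_div]
  refine sum_congr rfl fun ij hij => ?_
  have h : ij.1 + ij.2 = n := mem_antidiagonal.1 hij
  have h2 : (n.choose ij.1 : ℝ) * ij.1.factorial * ij.2.factorial = n.factorial := by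
    have := Nat.choose_mul_factorial_mul_factorial (show ij.1 ≤ n by omega)
    rw [show n - ij.1 = ij.2 by omega] at this
    exact_mod_cast this
  rw [← h2, ← h, pow_add]
  have h3 : ((ij.1 + ij.2).choose ij.1 : ℝ) ≠ 0 := by
    exact_mod_cast (Nat.choose_pos (Nat.le_add_right _ _)).ne'
  field_simp

theorem abs_prabhakarCoeff_le {k : ℝ} (hk : 0 < k) (ω x : ℝ) (n : ℕ) :
    |prabhakarCoeff k ω x n| ≤ prabhakarCoeff k |ω| |x| n := by
  unfold prabhakarCoeff
  rw [abs_div, abs_mul, abs_pow, Nat.abs_cast]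
  gcongr
  exact abs_kPochhammer_le hk x n

/-! ### The `k`-Mittag-Leffler series -/

theorem summable_kMittagLeffler_of_nonneg {k ρ δ x z : ℝ} (hk : 0 < k) (hρ : 0 < ρ) (hδ : 0 < δ)
    (hx : 0 ≤ x) (hz : 0 ≤ z) :
    Summable fun n : ℕ => kPochhammer k x n * z ^ n / (kGamma k (ρ * n + δ) * n.factorial) := by
  set M : ℝ := (x + k) * z + 1 with hM
  have hM1 : 0 < M := by positivity
  -- Chosen so that `S ^ (ρ / k) = 2 M`: the denominators then grow at least like `(2 M) ^ n n!`,
  -- against numerators of at most `M ^ n n!`.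
  set S : ℝ := (2 * M) ^ (k / ρ) with hSdef
  have hS : 0 < S := by positivity
  set C : ℝ := S ^ (δ / k - 1) * Real.exp (-(S / k)) with hC
  have hC0 : 0 < C := by positivity
  refine Summable.of_norm_bounded_eventually_nat (g := fun n : ℕ => C⁻¹ * (1 / 2 : ℝ) ^ n)
    (summable_geometric_two.mul_left _) ?_
  -- The lower bound on `kGamma` requires an argument of at least `k`, which holds only from this
  -- index on.
  filter_upwards [Filter.eventually_ge_atTop ⌈k / ρ⌉₊] with n hn
  have hn2 : k ≤ ρ * n + δ := by
    have : k / ρ ≤ n := Nat.ceil_le.1 hn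
    rw [div_le_iff₀ hρ] at this
    linarith
  have hG : (2 * M) ^ n * C ≤ kGamma k (ρ * n + δ) := by
    refine le_trans (le_of_eq ?_) (kGamma_ge hk hS hn2)
    rw [hC, ← mul_assoc]
    congr 1
    rw [show (ρ * n + δ) / k - 1 = ρ / k * n + (δ / k - 1) by ring, Real.rpow_add hS]
    congr 1
    rw [hSdef, ← Real.rpow_mul (by positivity),
      show k / ρ * (ρ / k * n) = n by field_simp, Real.rpow_natCast]
  have hGpos := kGamma_pos hk (show 0 < ρ * n + δ by positivity)
  have hP := kPochhammer_nonneg hk hx n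
  rw [Real.norm_of_nonneg (by positivity), div_le_iff₀ (by positivity)]
  calc kPochhammer k x n * z ^ n ≤ (n.factorial * (x + k) ^ n) * z ^ n := by
        gcongr; exact kPochhammer_le hk hx n
    _ = n.factorial * ((x + k) * z) ^ n := by rw [mul_pow]; ring
    _ ≤ n.factorial * M ^ n := by gcongr; linarith
    _ = C⁻¹ * (1 / 2) ^ n * (((2 * M) ^ n * C) * n.factorial) := by
        rw [mul_pow, div_pow, one_pow]; field_simp
    _ ≤ _ := by gcongr

theorem summable_norm_kMittagLeffler {k ρ δ : ℝ} (hk : 0 < k) (hρ : 0 < ρ) (hδ : 0 < δ)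
    (x z : ℝ) :
    Summable fun n : ℕ =>
      ‖kPochhammer k x n * z ^ n / (kGamma k (ρ * n + δ) * n.factorial)‖ := by
  refine Summable.of_nonneg_of_le (fun _ => norm_nonneg _) (fun n => ?_)
    (summable_kMittagLeffler_of_nonneg hk hρ hδ (abs_nonneg x) (abs_nonneg z))
  have hGpos := kGamma_pos hk (show 0 < ρ * n + δ by positivity)
  rw [norm_div, norm_mul, norm_pow, Real.norm_eq_abs, Real.norm_eq_abs,
    Real.norm_of_nonneg (show 0 ≤ kGamma k (ρ * n + δ) * n.factorial by positivity)]
  gcongr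
  exact abs_kPochhammer_le hk x n

theorem continuous_kMittagLeffler {k ρ δ : ℝ} (hk : 0 < k) (hρ : 0 < ρ) (hδ : 0 < δ) (x : ℝ) :
    Continuous (kMittagLeffler k ρ δ x) := by
  refine continuous_iff_continuousAt.2 fun z₀ => ?_
  have hc : ContinuousOn (kMittagLeffler k ρ δ x) (Metric.ball 0 (|z₀| + 1)) := by
    refine continuousOn_tsum (fun n => by fun_prop)
      (summable_norm_kMittagLeffler hk hρ hδ x (|z₀| + 1)) fun n z hz => ?_
    have hz' : |z| ≤ |(|z₀| + 1)| := by
      rw [abs_of_nonneg (by positivity : 0 ≤ |z₀| + 1)]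
      simpa using (mem_ball_zero_iff.1 hz).le
    rw [norm_div, norm_div, norm_mul, norm_mul (kPochhammer k x n), norm_mul, norm_pow, norm_pow]
    gcongr
    exact hz'
  exact hc.continuousAt (Metric.isOpen_ball.mem_nhds (by simp))

theorem kMittagLeffler_pos {k ρ δ x z : ℝ} (hk : 0 < k) (hρ : 0 < ρ) (hδ : 0 < δ)
    (hx : 0 < x) (hz : 0 < z) : 0 < kMittagLeffler k ρ δ x z := by
  have h : ∀ n : ℕ, 0 < kPochhammer k x n * z ^ n / (kGamma k (ρ * n + δ) * n.factorial) := by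
    intro n
    have hGpos := kGamma_pos hk (show 0 < ρ * n + δ by positivity)
    have := kPochhammer_pos hk hx n
    positivity
  exact (summable_kMittagLeffler_of_nonneg hk hρ hδ hx.le hz.le).tsum_pos
    (fun n => (h n).le) 0 (h 0)

/-! ### Power kernels -/

theorem powKernel_pos {k p s : ℝ} (hk : 0 < k) (hp : 0 < p) (hs : 0 < s) : 0 < powKernel k p s := by
  have := kGamma_pos hk hp
  unfold powKernel
  positivity

theorem powKernel_natCast_succ_mul {k : ℝ} (hk : 0 < k) (m : ℕ) (s : ℝ) :
    powKernel k (((m + 1 : ℕ) : ℝ) * k) s = s ^ m / (k ^ (m + 1) * m.factorial) := by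
  rw [powKernel, kGamma_natCast_succ_mul hk, mul_div_cancel_right₀ _ hk.ne']
  push_cast
  rw [add_sub_cancel_right, Real.rpow_natCast, pow_succ']
  ring

/-- Cut at the midpoint: on the left half only `s = 0` can be singular, and the reflection `s ↦ t -
s` turns the right half into the left one with the exponents swapped. -/
theorem intervalIntegrable_rpow_mul_sub_rpow {p q t : ℝ} (hp : 0 < p) (hq : 0 < q) (ht : 0 < t) :
    IntervalIntegrable (fun s => (t - s) ^ (p - 1) * s ^ (q - 1)) volume 0 t := by
  have hm : 0 < t / 2 := by positivity
  have key : ∀ p q : ℝ, 0 < p → 0 < q →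
      IntervalIntegrable (fun s => (t - s) ^ (p - 1) * s ^ (q - 1)) volume 0 (t / 2) := by
    intro p q hp hq
    refine IntervalIntegrable.continuousOn_mul
      (intervalIntegral.intervalIntegrable_rpow' (by linarith)) ?_
    rw [uIcc_of_le hm.le]
    refine ContinuousOn.rpow_const (by fun_prop) fun s hs => Or.inl ?_
    have := hs.2
    linarith
  refine (key p q hp hq).trans ?_
  have h := ((key q p hq hp).comp_sub_left t).symm
  rw [sub_zero, show t - t / 2 = t / 2 by ring] at h
  refine h.congr fun s _ => ?_
  simp [mul_comm]

theorem integral_rpow_mul_sub_rpow {p q t : ℝ} (hp : 0 < p) (hq : 0 < q) (ht : 0 < t) :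
    ∫ s in (0 : ℝ)..t, (t - s) ^ (p - 1) * s ^ (q - 1) =
      t ^ (p + q - 1) * (Real.Gamma p * Real.Gamma q / Real.Gamma (p + q)) := by
  have h := Complex.betaIntegral_scaled (q : ℂ) (p : ℂ) ht
  rw [Complex.betaIntegral_eq_Gamma_mul_div _ _ (by simpa) (by simpa)] at h
  have h2 : ((∫ s in (0 : ℝ)..t, (t - s) ^ (p - 1) * s ^ (q - 1) : ℝ) : ℂ) =
      ∫ x in (0 : ℝ)..t, (x : ℂ) ^ ((q : ℂ) - 1) * ((t : ℂ) - x) ^ ((p : ℂ) - 1) := by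
    rw [← intervalIntegral.integral_ofReal]
    refine intervalIntegral.integral_congr fun s hs => ?_
    rw [uIcc_of_le ht.le] at hs
    rw [Complex.ofReal_mul, Complex.ofReal_cpow (sub_nonneg.2 hs.2), Complex.ofReal_cpow hs.1]
    push_cast
    ring
  rw [← h2] at h
  apply Complex.ofReal_injective
  rw [h]
  push_cast [Complex.ofReal_cpow ht.le, Complex.Gamma_ofReal]
  rw [← Complex.Gamma_ofReal, ← Complex.Gamma_ofReal, ← Complex.Gamma_ofReal]
  push_cast
  rw [add_comm (q : ℂ) p, mul_comm (Complex.Gamma q)]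

theorem integrableOn_powKernel_mul {k p q t : ℝ} (hk : 0 < k) (hp : 0 < p) (hq : 0 < q)
    (ht : 0 < t) :
    IntegrableOn (fun s => powKernel k p (t - s) * powKernel k q s) (Ioc 0 t) := by
  have h := (intervalIntegrable_rpow_mul_sub_rpow (div_pos hp hk) (div_pos hq hk) ht).1
  refine (h.mul_const ((k * kGamma k p)⁻¹ * (k * kGamma k q)⁻¹)).congr
    (Filter.Eventually.of_forall fun s => ?_)
  simp only [powKernel]
  ring

theorem integral_powKernel_mul {k p q t : ℝ} (hk : 0 < k) (hp : 0 < p) (hq : 0 < q)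
    (ht : 0 < t) :
    ∫ s in Ioc 0 t, powKernel k p (t - s) * powKernel k q s = powKernel k (p + q) t := by
  have h := integral_rpow_mul_sub_rpow (div_pos hp hk) (div_pos hq hk) ht
  rw [intervalIntegral.integral_of_le ht.le] at h
  have h1 : ∀ s, powKernel k p (t - s) * powKernel k q s =
      ((k * kGamma k p)⁻¹ * (k * kGamma k q)⁻¹) *
        ((t - s) ^ (p / k - 1) * s ^ (q / k - 1)) := by
    intro s
    simp only [powKernel]
    ring
  simp_rw [h1]
  rw [integral_const_mul, h, powKernel, kGamma_eq hk hp, kGamma_eq hk hq, kGamma_eq hk (by positivity),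
    add_div, show p / k + q / k - 1 = (p / k - 1) + (q / k - 1) + 1 by ring,
    Real.rpow_add_one hk.ne', Real.rpow_add hk]
  have := (Real.Gamma_pos_of_pos (div_pos hp hk)).ne'
  have := (Real.Gamma_pos_of_pos (div_pos hq hk)).ne'
  have := (Real.Gamma_pos_of_pos (add_pos (div_pos hp hk) (div_pos hq hk))).ne'
  field_simp

/-! ### Expansion of the Prabhakar kernel and the semigroup property -/

theorem prabhakarCoeff_mul_powKernel (k ρ ω δ x : ℝ) {s : ℝ} (hs : 0 < s)
    (n : ℕ) :
    prabhakarCoeff k ω x n * powKernel k (ρ * n + δ) s =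
      s ^ (δ / k - 1) / k * (kPochhammer k x n * (ω * s ^ (ρ / k)) ^ n /
        (kGamma k (ρ * n + δ) * n.factorial)) := by
  rw [prabhakarCoeff, powKernel, mul_pow, ← Real.rpow_natCast (s ^ (ρ / k)), ← Real.rpow_mul hs.le,
    show (ρ * n + δ) / k - 1 = ρ / k * n + (δ / k - 1) by ring, Real.rpow_add hs]
  ring

theorem hasSum_prabhakarKernel {k ρ δ : ℝ} (hk : 0 < k) (hρ : 0 < ρ) (hδ : 0 < δ)
    (ω x : ℝ) {s : ℝ} (hs : 0 < s) :
    HasSum (fun n : ℕ => prabhakarCoeff k ω x n * powKernel k (ρ * n + δ) s)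
      (prabhakarKernel k ρ ω δ x s) := by
  simp_rw [prabhakarCoeff_mul_powKernel k ρ ω δ x hs]
  exact (summable_norm_kMittagLeffler hk hρ hδ x _).of_norm.hasSum.mul_left _

theorem summable_norm_prabhakarKernel {k ρ δ : ℝ} (hk : 0 < k) (hρ : 0 < ρ) (hδ : 0 < δ)
    (ω x : ℝ) {s : ℝ} (hs : 0 < s) :
    Summable (fun n : ℕ => ‖prabhakarCoeff k ω x n * powKernel k (ρ * n + δ) s‖) := by
  simp_rw [prabhakarCoeff_mul_powKernel k ρ ω δ x hs, norm_mul (s ^ (δ / k - 1) / k)]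
  exact (summable_norm_kMittagLeffler hk hρ hδ x _).mul_left _

theorem prabhakarCoeff_nonneg {k ω x : ℝ} (hk : 0 < k) (hω : 0 ≤ ω) (hx : 0 ≤ x) (n : ℕ) :
    0 ≤ prabhakarCoeff k ω x n := by
  have := kPochhammer_nonneg hk hx n
  unfold prabhakarCoeff
  positivity

/-- Dominate by the series for `|ω|`, `|x|`, `|y|`. Its terms are nonnegative, so it may be summed
along antidiagonals, where Chu-Vandermonde turns it into the convergent kernel series with parameter
`|x| + |y|`. -/
theorem summable_prabhakarCoeff_mul {k ρ δ : ℝ} (hk : 0 < k) (hρ : 0 < ρ) (hδ : 0 < δ)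
    (ω x y : ℝ) {t : ℝ} (ht : 0 < t) :
    Summable fun ij : ℕ × ℕ => |prabhakarCoeff k ω x ij.1| * |prabhakarCoeff k ω y ij.2| *
      powKernel k (ρ * (ij.1 + ij.2 : ℕ) + δ) t := by
  have hφ : ∀ n : ℕ, 0 < powKernel k (ρ * n + δ) t := fun n =>
    powKernel_pos hk (by positivity) ht
  have hc : ∀ (z : ℝ) (n : ℕ), 0 ≤ prabhakarCoeff k |ω| |z| n := fun z n =>
    prabhakarCoeff_nonneg hk (abs_nonneg _) (abs_nonneg _) n
  suffices h : Summable fun ij : ℕ × ℕ => prabhakarCoeff k |ω| |x| ij.1 *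
      prabhakarCoeff k |ω| |y| ij.2 * powKernel k (ρ * (ij.1 + ij.2 : ℕ) + δ) t by
    refine Summable.of_nonneg_of_le (fun ij => ?_) (fun ij => ?_) h
    · have := hφ (ij.1 + ij.2)
      positivity
    · have := hφ (ij.1 + ij.2)
      gcongr
      · exact hc x _
      · exact abs_prabhakarCoeff_le hk ω x _
      · exact abs_prabhakarCoeff_le hk ω y _
  rw [← Finset.HasAntidiagonal.sigmaAntidiagonalEquivProd.summable_iff,
    summable_sigma_of_nonneg]
  · refine ⟨fun n => Summable.of_finite, ?_⟩
    refine (hasSum_prabhakarKernel hk hρ hδ |ω| (|x| + |y|) ht).summable.congr fun n => ?_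
    rw [tsum_fintype, ← prabhakarCoeff_add, Finset.sum_mul, ← Finset.sum_coe_sort]
    refine Finset.sum_congr rfl fun ij _ => ?_
    have h : ij.1.1 + ij.1.2 = n := Finset.HasAntidiagonal.mem_antidiagonal.1 ij.2
    simp only [Function.comp, Finset.HasAntidiagonal.sigmaAntidiagonalEquivProd_apply, h]
  · intro ij
    exact mul_nonneg (mul_nonneg (hc x _) (hc y _)) (hφ _).le

/-- The semigroup property of the Prabhakar kernels. -/
theorem conv_prabhakarKernel {k ρ δ ε : ℝ} (hk : 0 < k) (hρ : 0 < ρ) (hδ : 0 < δ) (hε : 0 < ε)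
    (ω x y : ℝ) {t : ℝ} (ht : 0 < t) :
    conv 0 (prabhakarKernel k ρ ω δ x) (prabhakarKernel k ρ ω ε y) t =
      prabhakarKernel k ρ ω (δ + ε) (x + y) t := by
  set F : ℕ × ℕ → ℝ → ℝ := fun ij s =>
    (prabhakarCoeff k ω x ij.1 * powKernel k (ρ * ij.1 + δ) (t - s)) *
      (prabhakarCoeff k ω y ij.2 * powKernel k (ρ * ij.2 + ε) s) with hF
  have hF' : ∀ ij s, F ij s = (prabhakarCoeff k ω x ij.1 * prabhakarCoeff k ω y ij.2) *
      (powKernel k (ρ * ij.1 + δ) (t - s) * powKernel k (ρ * ij.2 + ε) s) := by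
    intro ij s
    simp only [hF]
    ring
  have hp : ∀ (p : ℝ) (n : ℕ), 0 < p → 0 < ρ * n + p := fun p n hp => by positivity
  have hint : ∀ ij : ℕ × ℕ, IntegrableOn (F ij) (Ioc 0 t) := by
    intro ij
    simp_rw [funext (hF' ij)]
    exact (integrableOn_powKernel_mul hk (hp _ _ hδ) (hp _ _ hε) ht).const_mul _
  have hval : ∀ ij : ℕ × ℕ, ∫ s in Ioc 0 t,
      powKernel k (ρ * ij.1 + δ) (t - s) * powKernel k (ρ * ij.2 + ε) s =
        powKernel k (ρ * (ij.1 + ij.2 : ℕ) + (δ + ε)) t := by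
    intro ij
    rw [integral_powKernel_mul hk (hp _ _ hδ) (hp _ _ hε) ht]
    congr 1
    push_cast
    ring
  -- Power kernels are positive, so the integrals of the norms are again beta integrals and form
  -- exactly the series shown summable above. This justifies integrating the double series term by
  -- term.
  have hnorm : Summable fun ij => ∫ s in Ioc 0 t, ‖F ij s‖ := by
    refine (summable_prabhakarCoeff_mul hk hρ (add_pos hδ hε) ω x y ht).congr fun ij => ?_
    rw [← hval, ← integral_const_mul, integral_Ioc_eq_integral_Ioo, integral_Ioc_eq_integral_Ioo]
    refine setIntegral_congr_fun measurableSet_Ioo fun s hs => ?_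
    have h1 := powKernel_pos hk (hp _ ij.1 hδ) (sub_pos.2 hs.2)
    have h2 := powKernel_pos hk (hp _ ij.2 hε) hs.1
    simp only [hF']
    rw [norm_mul, norm_mul, Real.norm_eq_abs, Real.norm_eq_abs, Real.norm_of_nonneg (by positivity)]
  have hsum := hasSum_integral_of_summable_integral_norm hint hnorm
  have hL : ∫ s in Ioc 0 t, ∑' ij, F ij s =
      conv 0 (prabhakarKernel k ρ ω δ x) (prabhakarKernel k ρ ω ε y) t := by
    rw [conv, intervalIntegral.integral_of_le ht.le, integral_Ioc_eq_integral_Ioo,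
      integral_Ioc_eq_integral_Ioo]
    refine setIntegral_congr_fun measurableSet_Ioo fun s hs => ?_
    have h1 := sub_pos.2 hs.2
    have h2 := hs.1
    simp only [hF]
    rw [← (hasSum_prabhakarKernel hk hρ hδ ω x h1).tsum_eq,
      ← (hasSum_prabhakarKernel hk hρ hε ω y h2).tsum_eq,
      tsum_mul_tsum_of_summable_norm (summable_norm_prabhakarKernel hk hρ hδ ω x h1)
        (summable_norm_prabhakarKernel hk hρ hε ω y h2)]
  rw [hL] at hsum
  have hI : ∀ ij, ∫ s in Ioc 0 t, F ij s = prabhakarCoeff k ω x ij.1 * prabhakarCoeff k ω y ij.2 *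
      powKernel k (ρ * (ij.1 + ij.2 : ℕ) + (δ + ε)) t := by
    intro ij
    simp_rw [hF']
    rw [integral_const_mul, hval]
  simp_rw [hI] at hsum
  -- Regroup by `i + j = n`: the power kernel depends on `n` alone, and the coefficients combine by
  -- `prabhakarCoeff_add`.
  have hs2 := (Finset.HasAntidiagonal.sigmaAntidiagonalEquivProd.hasSum_iff.2 hsum).sigma
    fun n => hasSum_fintype _
  refine hs2.unique ?_
  refine Eq.mp (congrArg (fun f => HasSum f _ _) (funext fun n => ?_))
    (hasSum_prabhakarKernel hk hρ (add_pos hδ hε) ω (x + y) ht)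
  rw [← prabhakarCoeff_add, Finset.sum_mul, ← Finset.sum_coe_sort]
  refine Finset.sum_congr rfl fun ij _ => ?_
  have h : ij.1.1 + ij.1.2 = n := Finset.HasAntidiagonal.mem_antidiagonal.1 ij.2
  simp only [Function.comp, Finset.HasAntidiagonal.sigmaAntidiagonalEquivProd_apply, h]

theorem prabhakarKernel_zero {k ρ δ : ℝ} (hk : 0 < k) (hρ : 0 < ρ) (hδ : 0 < δ) (ω : ℝ) {s : ℝ}
    (hs : 0 < s) : prabhakarKernel k ρ ω δ 0 s = powKernel k δ s := by
  refine (hasSum_prabhakarKernel hk hρ hδ ω 0 hs).unique ?_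
  convert hasSum_single (0 : ℕ) ?_ using 1
  · simp [prabhakarCoeff, kPochhammer]
  · intro n hn
    obtain ⟨m, rfl⟩ := Nat.exists_eq_succ_of_ne_zero hn
    simp [prabhakarCoeff, kPochhammer_zero_succ]

/-! ### Convolutions over `[a, t]` -/

theorem conv_congr {a t : ℝ} {K K' f f' : ℝ → ℝ} (hat : a ≤ t)
    (hK : EqOn K K' (Ioo 0 (t - a))) (hf : EqOn f f' (Ioo a t)) :
    conv a K f t = conv a K' f' t := by
  rw [conv, conv, intervalIntegral.integral_of_le hat, intervalIntegral.integral_of_le hat,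
    integral_Ioc_eq_integral_Ioo, integral_Ioc_eq_integral_Ioo]
  refine setIntegral_congr_fun measurableSet_Ioo fun u hu => ?_
  rw [hf hu, hK ⟨by linarith [hu.2], by linarith [hu.1]⟩]

theorem convolution_eq_conv {a t : ℝ} {F G : ℝ → ℝ} (hF : ∀ u ≤ a, F u = 0)
    (hG : ∀ s ≤ 0, G s = 0) (hat : a ≤ t) : (F ⋆[mul ℝ ℝ] G) t = conv a G F t := by
  rw [convolution_def, conv, intervalIntegral.integral_of_le hat, integral_Ioc_eq_integral_Ioo]
  rw [← integral_indicator measurableSet_Ioo]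
  congr 1
  ext u
  by_cases hu : u ∈ Ioo a t
  · simp [indicator_of_mem hu, mul_comm]
  · rw [indicator_of_notMem hu, ContinuousLinearMap.mul_apply']
    by_cases h1 : u ≤ a
    · simp [hF u h1]
    · have : t ≤ u := by
        by_contra h2
        exact hu ⟨not_le.1 h1, not_le.1 h2⟩
      rw [hG _ (by linarith), mul_zero]

theorem convolution_eq_zero {a t : ℝ} {F G : ℝ → ℝ} (hF : ∀ u ≤ a, F u = 0)
    (hG : ∀ s ≤ 0, G s = 0) (hat : t ≤ a) : (F ⋆[mul ℝ ℝ] G) t = 0 := by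
  rw [convolution_def]
  refine integral_eq_zero_of_ae (Eventually.of_forall fun u => ?_)
  simp only [ContinuousLinearMap.mul_apply', Pi.zero_apply]
  rcases le_or_gt u a with h | h
  · rw [hF u h, zero_mul]
  · rw [hG _ (by linarith), mul_zero]

theorem convolution_norm_le {K L : ℝ → ℝ} {C : ℝ} (hK : Integrable K) (hL : ∀ s, |L s| ≤ C)
    (x : ℝ) : ‖((fun s => ‖K s‖) ⋆[mul ℝ ℝ] fun s => ‖L s‖) x‖ ≤ C * ∫ s, ‖K s‖ := by
  rw [convolution_def, ← integral_const_mul]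
  refine norm_integral_le_of_norm_le (hK.norm.const_mul C) (Eventually.of_forall fun s => ?_)
  rw [ContinuousLinearMap.mul_apply', norm_mul, norm_norm, norm_norm, mul_comm]
  exact mul_le_mul_of_nonneg_right (hL _) (norm_nonneg _)

/-- For merely integrable functions associativity holds only almost everywhere. The bound on `‖K‖ *
‖L‖` makes the triple integral absolutely convergent at every `t`. -/
theorem convolution_assoc_of_bounded {F K L : ℝ → ℝ} {C : ℝ} (hF : Integrable F)
    (hK : Integrable K) (hL : Integrable L)
    (hC : ∀ x, ‖((fun s => ‖K s‖) ⋆[mul ℝ ℝ] fun s => ‖L s‖) x‖ ≤ C) (t : ℝ) :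
    ((F ⋆[mul ℝ ℝ] K) ⋆[mul ℝ ℝ] L) t = (F ⋆[mul ℝ ℝ] (K ⋆[mul ℝ ℝ] L)) t := by
  refine convolution_assoc _ _ _ _ (fun x y z => mul_assoc x y z) hF.1 hK.1 hL.1
    (hF.ae_convolution_exists _ hK) (hK.norm.ae_convolution_exists _ hL.norm) ?_
  have hm : AEStronglyMeasurable ((fun s => ‖K s‖) ⋆[mul ℝ ℝ] fun s => ‖L s‖) volume :=
    (hK.norm.integrable_convolution (mul ℝ ℝ) hL.norm).1
  refine Integrable.mono' (hF.norm.mul_const C)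
    (hF.norm.1.convolution_integrand_snd (mul ℝ ℝ) hm t) (Eventually.of_forall fun u => ?_)
  rw [ContinuousLinearMap.mul_apply', norm_mul, norm_norm]
  exact mul_le_mul_of_nonneg_left (hC _) (norm_nonneg _)

/-- Associativity of convolution over `[a, t]`, for two kernels one of which is bounded. -/
theorem conv_conv {a b C : ℝ} {K L f : ℝ → ℝ}
    (hf : IntegrableOn f (Ioo a b)) (hK : IntegrableOn K (Ioo 0 (b - a)))
    (hL : IntegrableOn L (Ioo 0 (b - a)))
    (hC : (∀ s ∈ Ioo 0 (b - a), |K s| ≤ C) ∨ (∀ s ∈ Ioo 0 (b - a), |L s| ≤ C))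
    {t : ℝ} (ht : t ∈ Icc a b) :
    conv a L (conv a K f) t = conv a (conv 0 L K) f t := by
  -- Extended by zero, the functions are supported to the right of `a` or of `0`, so that
  -- convolutions over the whole line reduce to integrals over `[a, t]`.
  set F := indicator (Ioo a b) f with hFdef
  set K' := indicator (Ioo 0 (b - a)) K with hKdef
  set L' := indicator (Ioo 0 (b - a)) L with hLdef
  have hF0 : ∀ u ≤ a, F u = 0 := fun u hu => indicator_of_notMem (fun h => hu.not_gt h.1) _
  have hK0 : ∀ u ≤ 0, K' u = 0 := fun u hu => indicator_of_notMem (fun h => hu.not_gt h.1) _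
  have hL0 : ∀ u ≤ 0, L' u = 0 := fun u hu => indicator_of_notMem (fun h => hu.not_gt h.1) _
  have hFi : Integrable F := hf.integrable_indicator measurableSet_Ioo
  have hKi : Integrable K' := hK.integrable_indicator measurableSet_Ioo
  have hLi : Integrable L' := hL.integrable_indicator measurableSet_Ioo
  have hKL : ∀ {s : ℝ}, s ≤ t - a → EqOn K' K (Ioo 0 s) ∧ EqOn L' L (Ioo 0 s) := by
    intro s hs
    have : Ioo 0 s ⊆ Ioo 0 (b - a) := Ioo_subset_Ioo_right (by linarith [ht.2])
    exact ⟨(eqOn_indicator).mono this, (eqOn_indicator).mono this⟩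
  have hFf : ∀ {s : ℝ}, s ≤ t → EqOn F f (Ioo a s) := fun {s} hs =>
    eqOn_indicator.mono (Ioo_subset_Ioo_right (hs.trans ht.2))
  have hbd : ∀ {M : ℝ → ℝ}, (∀ s ∈ Ioo 0 (b - a), |M s| ≤ C) →
      ∀ s, |indicator (Ioo 0 (b - a)) M s| ≤ |C| := by
    intro M hM s
    by_cases hs : s ∈ Ioo 0 (b - a)
    · rw [indicator_of_mem hs]
      exact (hM s hs).trans (le_abs_self C)
    · rw [indicator_of_notMem hs, abs_zero]
      exact abs_nonneg C
  have hassoc : ((F ⋆[mul ℝ ℝ] K') ⋆[mul ℝ ℝ] L') t = (F ⋆[mul ℝ ℝ] (K' ⋆[mul ℝ ℝ] L')) t := by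
    rcases hC with hC | hC
    · refine convolution_assoc_of_bounded (C := |C| * ∫ s, ‖L' s‖) hFi hKi hLi (fun x => ?_) t
      have h := convolution_norm_le hLi (hbd hC) x
      rwa [← convolution_flip, ContinuousLinearMap.flip_mul] at h
    · exact convolution_assoc_of_bounded hFi hKi hLi (convolution_norm_le hKi (hbd hC)) t
  rw [convolution_eq_conv (fun u hu => convolution_eq_zero hF0 hK0 hu) hL0 ht.1,
    convolution_eq_conv hF0 (fun u hu => convolution_eq_zero hK0 hL0 hu) ht.1] at hassoc
  calc conv a L (conv a K f) t = conv a L' (F ⋆[mul ℝ ℝ] K') t := by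
        refine conv_congr ht.1 (hKL le_rfl).2.symm fun u hu => ?_
        rw [convolution_eq_conv hF0 hK0 hu.1.le]
        exact (conv_congr hu.1.le (hKL (by linarith [hu.2])).1 (hFf hu.2.le)).symm
    _ = conv a (K' ⋆[mul ℝ ℝ] L') F t := hassoc
    _ = conv a (conv 0 L K) f t := by
        refine conv_congr ht.1 (fun s hs => ?_) (hFf le_rfl)
        rw [convolution_eq_conv hK0 hL0 hs.1.le]
        exact conv_congr hs.1.le (hKL (by linarith [hs.2])).2 (hKL hs.2.le).1

theorem continuousOn_conv {a b : ℝ} {K f : ℝ → ℝ} (hf : IntegrableOn f (Ioo a b))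
    (hK : Continuous K) (hK0 : K 0 = 0) : ContinuousOn (conv a K f) (Icc a b) := by
  rcases lt_or_ge b a with hab | hab
  · simp [Icc_eq_empty hab.not_ge]
  have hab' : 0 ≤ b - a := sub_nonneg.2 hab
  -- Clamping the argument makes the kernel bounded and keeps it continuous. Since `K 0 = 0`, it
  -- also vanishes on the negative axis, as a causal kernel must.
  set G : ℝ → ℝ := fun s => K (projIcc 0 (b - a) hab' s) with hG
  have hGc : Continuous G := hK.comp (continuous_subtype_val.comp continuous_projIcc)
  have hb : BddAbove (range fun x => ‖G x‖) := by
    obtain ⟨C, hC⟩ := (isCompact_Icc (a := (0 : ℝ)) (b := b - a)).exists_bound_of_continuousOn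
      hK.continuousOn
    refine ⟨C, ?_⟩
    rintro _ ⟨x, rfl⟩
    exact hC _ (projIcc 0 (b - a) hab' x).2
  have hc := hb.continuous_convolution_right_of_integrable (mul ℝ ℝ)
    (hf.integrable_indicator measurableSet_Ioo) hGc
  refine hc.continuousOn.congr fun t ht => ?_
  rw [convolution_eq_conv (fun u hu => indicator_of_notMem (fun h => hu.not_gt h.1) _)
    (fun s hs => by simp [hG, projIcc_of_le_left _ hs, hK0]) ht.1]
  refine conv_congr ht.1 (fun s hs => ?_) fun u hu => ?_
  · simp only [hG]
    rw [projIcc_of_mem hab' (show s ∈ Icc 0 (b - a) from ⟨hs.1.le, by linarith [hs.2, ht.2]⟩)]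
  · rw [indicator_of_mem (show u ∈ Ioo a b from ⟨hu.1, hu.2.trans_le ht.2⟩)]

theorem conv_shift (a : ℝ) (K f : ℝ → ℝ) (t : ℝ) :
    conv a K (fun u => f (u - a)) t = conv 0 K f (t - a) := by
  have h := intervalIntegral.integral_comp_sub_right (a := a) (b := t)
    (fun s => K (t - a - s) * f s) a
  rw [sub_self] at h
  rw [conv, conv, ← h]
  simp

theorem intervalIntegrable_conv_of_continuousOn {a b t : ℝ} {K f : ℝ → ℝ} (ht : t ∈ Icc a b)
    (hK : IntegrableOn K (Ioo 0 (b - a))) (hf : ContinuousOn f (Icc a b)) :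
    IntervalIntegrable (fun u => K (t - u) * f u) volume a t := by
  refine IntervalIntegrable.mul_continuousOn ?_ ?_
  · have h : IntervalIntegrable K volume 0 (t - a) := by
      rw [intervalIntegrable_iff_integrableOn_Ioo_of_le (by linarith [ht.1])]
      exact hK.mono_set (Ioo_subset_Ioo_right (by linarith [ht.2]))
    simpa using (h.comp_sub_left t).symm
  · rw [uIcc_of_le ht.1]
    exact hf.mono (Icc_subset_Icc_right ht.2)

theorem intervalIntegrable_conv_of_continuous {a b t : ℝ} {K f : ℝ → ℝ} (ht : t ∈ Icc a b)
    (hK : Continuous K) (hf : IntegrableOn f (Ioo a b)) :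
    IntervalIntegrable (fun u => K (t - u) * f u) volume a t := by
  refine IntervalIntegrable.continuousOn_mul ?_ (by fun_prop)
  rw [intervalIntegrable_iff_integrableOn_Ioo_of_le ht.1]
  exact hf.mono_set (Ioo_subset_Ioo_right ht.2)

theorem conv_const_mul (a : ℝ) (K f : ℝ → ℝ) (c t : ℝ) :
    conv a K (fun u => c * f u) t = c * conv a K f t := by
  rw [conv, conv, ← intervalIntegral.integral_const_mul]
  congr 1
  ext u
  ring

theorem conv_sub {a b t : ℝ} {K f g : ℝ → ℝ} (ht : t ∈ Icc a b)
    (hK : IntegrableOn K (Ioo 0 (b - a))) (hf : ContinuousOn f (Icc a b))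
    (hg : ContinuousOn g (Icc a b)) :
    conv a K (fun u => f u - g u) t = conv a K f t - conv a K g t := by
  rw [conv, conv, conv, ← intervalIntegral.integral_sub
    (intervalIntegrable_conv_of_continuousOn ht hK hf)
    (intervalIntegrable_conv_of_continuousOn ht hK hg)]
  congr 1
  ext u
  ring

/-! ### Repeated integrals -/

/-- The `(m + 1)`-fold iterated integral of `h` from `a`, by Cauchy's formula. -/
def repeatedIntegral (a : ℝ) (h : ℝ → ℝ) (m : ℕ) : ℝ → ℝ :=
  conv a (fun s => s ^ m / m.factorial) h

theorem repeatedIntegral_zero (a : ℝ) (h : ℝ → ℝ) (t : ℝ) :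
    repeatedIntegral a h 0 t = ∫ u in a..t, h u := by
  simp [repeatedIntegral, conv]

theorem continuousOn_repeatedIntegral {a b : ℝ} {h : ℝ → ℝ} (hab : a ≤ b)
    (hh : IntegrableOn h (Ioo a b)) (m : ℕ) :
    ContinuousOn (repeatedIntegral a h m) (Icc a b) := by
  cases m with
  | zero =>
    rw [funext (repeatedIntegral_zero a h)]
    have := intervalIntegral.continuousOn_primitive_interval (a := a) (b := b) (μ := volume) (f := h)
      (by rw [uIcc_of_le hab, integrableOn_Icc_iff_integrableOn_Ioo]; exact hh)
    rwa [uIcc_of_le hab] at this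
  | succ m => exact continuousOn_conv hh (by fun_prop) (by simp)

theorem repeatedIntegral_succ {a b t : ℝ} {h : ℝ → ℝ}
    (hh : IntegrableOn h (Ioo a b)) (m : ℕ) (ht : t ∈ Icc a b) :
    repeatedIntegral a h (m + 1) t = ∫ u in a..t, repeatedIntegral a h m u := by
  have hi : ∀ n : ℕ, IntegrableOn (fun s : ℝ => s ^ n / n.factorial) (Ioo 0 (b - a)) := fun n =>
    ((Continuous.integrableOn_Icc (by fun_prop)).mono_set Ioo_subset_Icc_self)
  have hc := conv_conv (C := 1) hh (hi m) (hi 0) (Or.inr (by simp)) ht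
  rw [← repeatedIntegral_zero, repeatedIntegral, repeatedIntegral, repeatedIntegral, hc]
  congr 1
  ext x
  simp only [conv, pow_zero, Nat.factorial_zero, Nat.cast_one, div_one, one_mul]
  rw [intervalIntegral.integral_div, integral_pow, Nat.factorial_succ]
  push_cast
  field_simp
  simp

theorem hasDerivAt_primitive_of_continuousOn {a b t : ℝ} {g : ℝ → ℝ}
    (hg : ContinuousOn g (Ioo a b)) (hgi : IntegrableOn g (Ioo a b)) (ht : t ∈ Ioo a b) :
    HasDerivAt (fun s => ∫ u in a..s, g u) (g t) t := by
  refine intervalIntegral.integral_hasDerivAt_right ?_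
    (hg.stronglyMeasurableAtFilter isOpen_Ioo t ht) (hg.continuousAt (isOpen_Ioo.mem_nhds ht))
  rw [intervalIntegrable_iff_integrableOn_Ioo_of_le ht.1.le]
  exact hgi.mono_set (Ioo_subset_Ioo_right ht.2.le)

theorem hasDerivAt_repeatedIntegral_zero {a b t : ℝ} {h : ℝ → ℝ}
    (hc : ContinuousOn h (Ioo a b)) (hh : IntegrableOn h (Ioo a b)) (ht : t ∈ Ioo a b) :
    HasDerivAt (repeatedIntegral a h 0) (h t) t := by
  rw [funext (repeatedIntegral_zero a h)]
  exact hasDerivAt_primitive_of_continuousOn hc hh ht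

theorem hasDerivAt_repeatedIntegral_succ {a b t : ℝ} {h : ℝ → ℝ}
    (hh : IntegrableOn h (Ioo a b)) (m : ℕ) (ht : t ∈ Ioo a b) :
    HasDerivAt (repeatedIntegral a h (m + 1)) (repeatedIntegral a h m t) t := by
  have hc := continuousOn_repeatedIntegral (ht.1.trans ht.2).le hh m
  refine (hasDerivAt_primitive_of_continuousOn (hc.mono Ioo_subset_Icc_self)
    (hc.integrableOn_Icc.mono_set Ioo_subset_Icc_self) ht).congr_of_eventuallyEq ?_
  filter_upwards [isOpen_Ioo.mem_nhds ht] with s hs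
  exact repeatedIntegral_succ hh m ⟨hs.1.le, hs.2.le⟩

theorem abs_repeatedIntegral_le {a b t : ℝ} {h : ℝ → ℝ}
    (hh : IntegrableOn h (Ioo a b)) (m : ℕ) (ht : t ∈ Icc a b) :
    |repeatedIntegral a h m t| ≤ (t - a) ^ m * ∫ u in Ioo a b, |h u| := by
  have hsub : Ioo a t ⊆ Ioo a b := Ioo_subset_Ioo_right ht.2
  rw [repeatedIntegral, conv, intervalIntegral.integral_of_le ht.1, integral_Ioc_eq_integral_Ioo]
  calc |∫ u in Ioo a t, (t - u) ^ m / m.factorial * h u|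
      ≤ ∫ u in Ioo a t, (t - a) ^ m * |h u| := by
        rw [← Real.norm_eq_abs]
        refine norm_integral_le_of_norm_le (((hh.mono_set hsub).abs).const_mul ((t - a) ^ m)) ?_
        filter_upwards [ae_restrict_mem measurableSet_Ioo] with u hu
        have h0 : 0 ≤ t - u := sub_nonneg.2 hu.2.le
        rw [norm_mul, Real.norm_of_nonneg (by positivity), Real.norm_eq_abs]
        gcongr
        calc (t - u) ^ m / m.factorial ≤ (t - u) ^ m :=
              div_le_self (by positivity) (by exact_mod_cast Nat.factorial_pos m)
          _ ≤ (t - a) ^ m := by gcongr; exact hu.1.le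
    _ = (t - a) ^ m * ∫ u in Ioo a t, |h u| := integral_const_mul _ _
    _ ≤ _ := by
        gcongr
        · exact pow_nonneg (sub_nonneg.2 ht.1) m
        · exact Eventually.of_forall fun u => abs_nonneg _
        · exact hh.abs

/-! ### Chains of derivatives -/

/-- Derivatives are local, so on an open set an explicit chain of derivatives determines
`iteratedDeriv`, whatever `F` does outside. -/
theorem iteratedDeriv_eqOn_of_hasDerivAt {s : Set ℝ} (hs : IsOpen s) {m : ℕ} {F : ℝ → ℝ}
    {f : ℕ → ℝ → ℝ} (h0 : EqOn F (f 0) s)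
    (hf : ∀ j < m, ∀ t ∈ s, HasDerivAt (f j) (f (j + 1) t) t) :
    ∀ j ≤ m, EqOn (iteratedDeriv j F) (f j) s := by
  intro j
  induction j with
  | zero => intro _; simpa using h0
  | succ j ih =>
    intro hj t ht
    rw [iteratedDeriv_succ]
    have h1 : iteratedDeriv j F =ᶠ[𝓝 t] f j := (ih (by omega)).eventuallyEq_of_mem (hs.mem_nhds ht)
    rw [h1.deriv_eq]
    exact (hf j (by omega) t ht).deriv

theorem differentiableOn_iteratedDeriv_of_hasDerivAt {s : Set ℝ} (hs : IsOpen s) {m : ℕ}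
    {F : ℝ → ℝ} {f : ℕ → ℝ → ℝ} (h0 : EqOn F (f 0) s)
    (hf : ∀ j < m, ∀ t ∈ s, HasDerivAt (f j) (f (j + 1) t) t) :
    ∀ j < m, DifferentiableOn ℝ (iteratedDeriv j F) s := fun j hj t ht =>
  ((hf j hj t ht).differentiableAt.differentiableWithinAt).congr
    (iteratedDeriv_eqOn_of_hasDerivAt hs h0 hf j hj.le)
    (iteratedDeriv_eqOn_of_hasDerivAt hs h0 hf j hj.le ht)

/-- The functions `repeatedIntegral a h (m - 1 - j)`, for `j < m`, followed by `h`. -/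
def integralChain (a : ℝ) (h : ℝ → ℝ) (m j : ℕ) : ℝ → ℝ :=
  if j < m then repeatedIntegral a h (m - 1 - j) else h

theorem hasDerivAt_integralChain {a b : ℝ} {h : ℝ → ℝ}
    (hc : ContinuousOn h (Ioo a b)) (hh : IntegrableOn h (Ioo a b)) (m : ℕ) :
    ∀ j < m, ∀ t ∈ Ioo a b, HasDerivAt (integralChain a h m j) (integralChain a h m (j + 1) t) t := by
  intro j hj t ht
  unfold integralChain
  rw [if_pos hj]
  split_ifs with h1
  · have := hasDerivAt_repeatedIntegral_succ hh (m - 1 - (j + 1)) ht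
    rwa [show m - 1 - (j + 1) + 1 = m - 1 - j by omega] at this
  · rw [show m - 1 - j = 0 by omega]
    exact hasDerivAt_repeatedIntegral_zero hc hh ht

theorem eq_zero_of_repeatedIntegral_eq_zero {a b : ℝ} {w : ℝ → ℝ} {m : ℕ} (hab : a < b)
    (hw : ContinuousOn w (Icc a b)) (h0 : ∀ t ∈ Ioo a b, repeatedIntegral a w m t = 0) :
    ∀ t ∈ Icc a b, w t = 0 := by
  have hwi : IntegrableOn w (Ioo a b) := hw.integrableOn_Icc.mono_set Ioo_subset_Icc_self
  have h1 := iteratedDeriv_eqOn_of_hasDerivAt isOpen_Ioo (F := fun _ => 0)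
    (fun t ht => by simp [integralChain, h0 t ht])
    (hasDerivAt_integralChain (hw.mono Ioo_subset_Icc_self) hwi (m + 1)) (m + 1) le_rfl
  have h2 : EqOn w (fun _ => 0) (Ioo a b) := fun t ht => by
    have := h1 ht
    simp only [integralChain, lt_irrefl, if_false] at this
    rw [← this]
    simp
  have h3 := h2.of_subset_closure hw continuousOn_const Ioo_subset_Icc_self
    (by rw [closure_Ioo hab.ne])
  exact h3

/-! ### Functions with a vanishing iterated derivative -/

theorem hasDerivAt_sub_pow_div_factorial (a t : ℝ) (i : ℕ) :
    HasDerivAt (fun s => (s - a) ^ (i + 1) / (i + 1).factorial) ((t - a) ^ i / i.factorial) t := by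
  have h := (((hasDerivAt_id t).sub_const a).pow (i + 1)).div_const ((i + 1).factorial : ℝ)
  refine h.congr_deriv ?_
  rw [Nat.factorial_succ]
  push_cast
  simp only [id]
  field_simp

/-- Apply induction to the chain starting at `D 1` and integrate the polynomial found; the
difference from `D 0` has zero derivative on an interval, hence is constant. -/
theorem exists_sum_of_hasDerivAt_chain {a b : ℝ} (n : ℕ) {D : ℕ → ℝ → ℝ}
    (hD : ∀ j < n, ∀ t ∈ Ioo a b, HasDerivAt (D j) (D (j + 1) t) t)
    (h0 : ∀ t ∈ Ioo a b, D n t = 0) :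
    ∃ c : ℕ → ℝ, ∀ t ∈ Ioo a b,
      D 0 t = ∑ i ∈ Finset.range n, c i * ((t - a) ^ i / i.factorial) := by
  induction n generalizing D with
  | zero => exact ⟨0, by simpa using h0⟩
  | succ n ih =>
    obtain ⟨c, hc⟩ := ih (D := fun j => D (j + 1)) (fun j hj => hD (j + 1) (by omega)) h0
    have hd : ∀ t ∈ Ioo a b, HasDerivAt (fun s => D 0 s -
        ∑ i ∈ Finset.range n, c i * ((s - a) ^ (i + 1) / (i + 1).factorial)) 0 t := by
      intro t ht
      have h2 : HasDerivAt (fun s => ∑ i ∈ Finset.range n,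
          c i * ((s - a) ^ (i + 1) / (i + 1).factorial)) (D (0 + 1) t) t := by
        rw [hc t ht]
        exact HasDerivAt.fun_sum fun i _ => (hasDerivAt_sub_pow_div_factorial a t i).const_mul (c i)
      exact ((hD 0 (by omega) t ht).fun_sub h2).congr_deriv (sub_self _)
    obtain ⟨r, hr⟩ := isOpen_Ioo.exists_is_const_of_deriv_eq_zero (isPreconnected_Ioo (a := a) (b := b))
      (fun t ht => (hd t ht).differentiableAt.differentiableWithinAt)
      (fun t ht => (hd t ht).deriv)
    refine ⟨fun i => if i = 0 then r else c (i - 1), fun t ht => ?_⟩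
    have := hr t ht
    rw [Finset.sum_range_succ']
    simp only [pow_zero, Nat.factorial_zero, Nat.cast_one, div_one, mul_one, if_true,
      Nat.succ_ne_zero, if_false, Nat.add_sub_cancel]
    linarith

theorem coeff_zero_eq_zero_of_isLittleO (n : ℕ) {c : ℕ → ℝ}
    (h : (fun s : ℝ => ∑ i ∈ Finset.range (n + 1), c i * s ^ i) =o[𝓝[>] 0] fun s => s ^ n) :
    c 0 = 0 := by
  have hc : Continuous fun s : ℝ => ∑ i ∈ Finset.range (n + 1), c i * s ^ i := by fun_prop
  have hlim := hc.tendsto 0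
  rw [Finset.sum_range_succ'] at hlim
  simp only [pow_succ, mul_zero, Finset.sum_const_zero, pow_zero, mul_one, zero_add] at hlim
  have hb : (fun s : ℝ => s ^ n) =O[𝓝[>] 0] fun _ => (1 : ℝ) :=
    ((continuous_pow n).tendsto (0 : ℝ)).isBigO_one ℝ |>.mono nhdsWithin_le_nhds
  exact tendsto_nhds_unique (hlim.mono_left nhdsWithin_le_nhds)
    ((isLittleO_one_iff ℝ).1 (h.trans_isBigO hb))

/-- Letting `s → 0` kills the constant term; divide by `s` and repeat. -/
theorem coeff_eq_zero_of_isLittleO (n : ℕ) {c : ℕ → ℝ}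
    (h : (fun s : ℝ => ∑ i ∈ Finset.range (n + 1), c i * s ^ i) =o[𝓝[>] 0] fun s => s ^ n) :
    ∀ i ≤ n, c i = 0 := by
  have hz := coeff_zero_eq_zero_of_isLittleO n h
  induction n generalizing c with
  | zero =>
    intro i hi
    obtain rfl : i = 0 := by omega
    exact hz
  | succ n ih =>
    have h1 : (fun s : ℝ => ∑ i ∈ Finset.range (n + 1), c (i + 1) * s ^ i) =o[𝓝[>] 0]
        fun s => s ^ n := by
      have h2 := (isBigO_refl (fun s : ℝ => s⁻¹) (𝓝[>] 0)).mul_isLittleO h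
      refine h2.congr' ?_ ?_
      · filter_upwards [self_mem_nhdsWithin] with s hs
        have hs' : s ≠ 0 := ne_of_gt hs
        rw [Finset.sum_range_succ', hz, zero_mul, add_zero, Finset.mul_sum]
        refine Finset.sum_congr rfl fun i _ => ?_
        rw [pow_succ]
        field_simp
      · filter_upwards [self_mem_nhdsWithin] with s hs
        have hs' : s ≠ 0 := ne_of_gt hs
        rw [pow_succ]
        field_simp
    have h2 := ih (c := fun i => c (i + 1)) h1
      (coeff_zero_eq_zero_of_isLittleO n (c := fun i => c (i + 1)) h1)
    intro i hi
    cases i with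
    | zero => exact hz
    | succ i => exact h2 i (by omega)

theorem isLittleO_conv {a b ν C : ℝ} {n : ℕ} {B y : ℝ → ℝ} (hab : a < b) (hC : 0 < C)
    (hν : 0 < ν) (hn : (n : ℝ) ≤ ν) (hB : ∀ s ∈ Ioo 0 (b - a), |B s| ≤ C * s ^ (ν - 1))
    (hy : ContinuousOn y (Icc a b)) (hya : y a = 0) :
    conv a B y =o[𝓝[>] a] fun t => (t - a) ^ n := by
  refine isLittleO_iff.2 fun c hc => ?_
  -- Since `(t - u) ^ (ν - 1)` integrates to `(t - a) ^ ν / ν`, a bound `|y| < ε` near `a` gives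
  -- exactly `c (t - a) ^ ν`. Keeping `t - a < 1` then allows `ν` to be lowered to `n`.
  set ε := c * ν / C with hε
  have hε0 : 0 < ε := by positivity
  have hy0 : ∀ᶠ u in 𝓝[Icc a b] a, |y u| < ε := by
    have h := (hy a (left_mem_Icc.2 hab.le)).tendsto.abs
    rw [hya, abs_zero] at h
    exact h.eventually (gt_mem_nhds hε0)
  obtain ⟨r, hr0, hr⟩ := Metric.mem_nhdsWithin_iff.1 hy0
  have hmem : Ioo a (min b (min (a + r) (a + 1))) ∈ 𝓝[>] a :=
    Ioo_mem_nhdsGT (by simp [hab, hr0])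
  filter_upwards [hmem] with t ht
  have htb : t < b := ht.2.trans_le (min_le_left _ _)
  have htr : t < a + r := ht.2.trans_le ((min_le_right _ _).trans (min_le_left _ _))
  have ht1 : t < a + 1 := ht.2.trans_le ((min_le_right _ _).trans (min_le_right _ _))
  have hta : 0 < t - a := sub_pos.2 ht.1
  have hint : IntervalIntegrable (fun u => (t - u) ^ (ν - 1)) volume a t := by
    have h : IntervalIntegrable (fun s : ℝ => s ^ (ν - 1)) volume 0 (t - a) :=
      intervalIntegral.intervalIntegrable_rpow' (by linarith)
    simpa using (h.comp_sub_left t).symm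
  have hval : ∫ u in a..t, (t - u) ^ (ν - 1) = (t - a) ^ ν / ν := by
    rw [intervalIntegral.integral_comp_sub_left (fun s => s ^ (ν - 1)) t, sub_self,
      integral_rpow (Or.inl (by linarith))]
    simp [hν.ne']
  calc ‖conv a B y t‖ ≤ ∫ u in a..t, C * ε * (t - u) ^ (ν - 1) := by
        rw [conv, intervalIntegral.integral_of_le ht.1.le, intervalIntegral.integral_of_le ht.1.le,
          integral_Ioc_eq_integral_Ioo, integral_Ioc_eq_integral_Ioo]
        refine norm_integral_le_of_norm_le ?_ ?_
        · exact (intervalIntegrable_iff_integrableOn_Ioo_of_le ht.1.le).1 (hint.const_mul _)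
        · filter_upwards [ae_restrict_mem measurableSet_Ioo] with u hu
          have h1 := hB (t - u) ⟨sub_pos.2 hu.2, by linarith [hu.1]⟩
          have h2 : |y u| < ε := hr ⟨by
            rw [Metric.mem_ball, Real.dist_eq, abs_of_pos (sub_pos.2 hu.1)]
            linarith [hu.2], hu.1.le, by linarith [hu.2]⟩
          rw [norm_mul, Real.norm_eq_abs, Real.norm_eq_abs, mul_right_comm]
          exact mul_le_mul h1 h2.le (abs_nonneg _) ((abs_nonneg _).trans h1)
    _ = c * (t - a) ^ ν := by
        rw [intervalIntegral.integral_const_mul, hval, hε]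
        field_simp
    _ ≤ c * ‖(t - a) ^ n‖ := by
        rw [Real.norm_of_nonneg (by positivity), ← Real.rpow_natCast (t - a) n]
        exact mul_le_mul_of_nonneg_left
          (Real.rpow_le_rpow_of_exponent_ge hta (by linarith) hn) hc.le

theorem isLittleO_repeatedIntegral {a b : ℝ} {h : ℝ → ℝ} (hab : a < b)
    (hh : IntegrableOn h (Ioo a b)) (n : ℕ) :
    repeatedIntegral a h (n + 1) =o[𝓝[>] a] fun t => (t - a) ^ n := by
  have h1 : repeatedIntegral a h (n + 1) =O[𝓝[>] a] fun t => (t - a) ^ (n + 1) := by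
    refine IsBigO.of_bound (∫ u in Ioo a b, |h u|) ?_
    filter_upwards [Ioo_mem_nhdsGT hab] with t ht
    have h2 := abs_repeatedIntegral_le hh (n + 1) ⟨ht.1.le, ht.2.le⟩
    rw [Real.norm_eq_abs, Real.norm_of_nonneg (pow_nonneg (sub_nonneg.2 ht.1.le) _), mul_comm]
    exact h2
  refine h1.trans_isLittleO ?_
  have h3 : (fun t : ℝ => t - a) =o[𝓝[>] a] fun _ => (1 : ℝ) := by
    rw [isLittleO_one_iff]
    have : Tendsto (fun t : ℝ => t - a) (𝓝 a) (𝓝 (a - a)) := (continuous_sub_right a).tendsto a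
    rw [sub_self] at this
    exact this.mono_left nhdsWithin_le_nhds
  simpa [pow_succ] using (isBigO_refl (fun t : ℝ => (t - a) ^ n) (𝓝[>] a)).mul_isLittleO h3

/-! ### Pairs of kernels that are inverse to each other up to repeated integration -/

/-- The convolution of `A` and `B` is `κ⁻¹` times the kernel of the `(n + 1)`-fold integral. -/
structure IsInversePair (T κ : ℝ) (n : ℕ) (A B : ℝ → ℝ) : Prop where
  ne_zero : κ ≠ 0
  continuous : Continuous A
  apply_zero : A 0 = 0
  integrable : IntegrableOn B (Ioo 0 T)
  conv_left : ∀ s ∈ Ioo 0 T, conv 0 A B s = κ⁻¹ * (s ^ n / n.factorial)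
  conv_right : ∀ s ∈ Ioo 0 T, conv 0 B A s = κ⁻¹ * (s ^ n / n.factorial)

namespace IsInversePair

variable {a b κ : ℝ} {n : ℕ} {A B : ℝ → ℝ}

theorem exists_bound (H : IsInversePair (b - a) κ n A B) :
    ∃ C, ∀ s ∈ Ioo 0 (b - a), |A s| ≤ C := by
  obtain ⟨C, hC⟩ := (isCompact_Icc (a := (0 : ℝ)) (b := b - a)).exists_bound_of_continuousOn
    H.continuous.continuousOn
  exact ⟨C, fun s hs => hC s (Ioo_subset_Icc_self hs)⟩

theorem integrable_left (H : IsInversePair (b - a) κ n A B) : IntegrableOn A (Ioo 0 (b - a)) :=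
  H.continuous.integrableOn_Icc.mono_set Ioo_subset_Icc_self

theorem conv_kernel {K h : ℝ → ℝ}
    (hK : ∀ s ∈ Ioo 0 (b - a), K s = κ⁻¹ * (s ^ n / n.factorial)) {t : ℝ} (ht : t ∈ Icc a b) :
    conv a K h t = κ⁻¹ * repeatedIntegral a h n t := by
  rw [conv_congr (K' := fun s => κ⁻¹ * (s ^ n / n.factorial)) ht.1
    (fun s hs => hK s ⟨hs.1, by linarith [hs.2, ht.2]⟩) (fun _ _ => rfl),
    repeatedIntegral, conv, conv, ← intervalIntegral.integral_const_mul]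
  simp only [mul_assoc]

theorem conv_left_conv (H : IsInversePair (b - a) κ n A B) {h : ℝ → ℝ}
    (hh : IntegrableOn h (Ioo a b)) {t : ℝ} (ht : t ∈ Icc a b) :
    conv a A (conv a B h) t = κ⁻¹ * repeatedIntegral a h n t := by
  obtain ⟨C, hC⟩ := H.exists_bound
  rw [conv_conv hh H.integrable H.integrable_left (Or.inr hC) ht, conv_kernel H.conv_left ht]

theorem conv_right_conv (H : IsInversePair (b - a) κ n A B) {h : ℝ → ℝ}
    (hh : IntegrableOn h (Ioo a b)) {t : ℝ} (ht : t ∈ Icc a b) :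
    conv a B (conv a A h) t = κ⁻¹ * repeatedIntegral a h n t := by
  obtain ⟨C, hC⟩ := H.exists_bound
  rw [conv_conv hh H.integrable_left H.integrable (Or.inl hC) ht, conv_kernel H.conv_right ht]

/-- Convolving with `A` turns `B * w = 0` into a vanishing repeated integral of `w`, which can be
differentiated away. -/
theorem eq_zero_of_conv_eq_zero (H : IsInversePair (b - a) κ n A B) (hab : a < b) {w : ℝ → ℝ}
    (hw : ContinuousOn w (Icc a b)) (h0 : ∀ t ∈ Ioo a b, conv a B w t = 0) :
    ∀ t ∈ Icc a b, w t = 0 := by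
  refine eq_zero_of_repeatedIntegral_eq_zero (m := n) hab hw fun t ht => ?_
  have h1 := H.conv_left_conv (hw.integrableOn_Icc.mono_set Ioo_subset_Icc_self)
    (Ioo_subset_Icc_self ht)
  rw [conv_congr (K' := A) (f' := fun _ => 0) ht.1.le (fun _ _ => rfl)
    (fun u hu => h0 u ⟨hu.1, hu.2.trans ht.2⟩)] at h1
  simpa [conv, H.ne_zero] using h1.symm

theorem continuousOn_solution (H : IsInversePair (b - a) κ n A B) {h : ℝ → ℝ}
    (hh : IntegrableOn h (Ioo a b)) (c : ℝ) :
    ContinuousOn (fun t => c * A (t - a) - conv a A h t) (Icc a b) := by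
  have := H.continuous
  exact ContinuousOn.sub (by fun_prop) (continuousOn_conv hh H.continuous H.apply_zero)

theorem conv_solution (H : IsInversePair (b - a) κ n A B) {h : ℝ → ℝ}
    (hh : IntegrableOn h (Ioo a b)) (c : ℝ) {t : ℝ} (ht : t ∈ Ioo a b) :
    conv a B (fun t => c * A (t - a) - conv a A h t) t =
      κ⁻¹ * (c * ((t - a) ^ n / n.factorial) - repeatedIntegral a h n t) := by
  have hA := H.continuous
  have ht' := Ioo_subset_Icc_self ht
  rw [conv_sub ht' H.integrable (by fun_prop)
    (continuousOn_conv hh H.continuous H.apply_zero), H.conv_right_conv hh ht',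
    conv_const_mul a B (fun u => A (u - a)), conv_shift,
    H.conv_right (t - a) ⟨by linarith [ht.1], by linarith [ht.2]⟩]
  ring

theorem hasDerivAt_chain (c a : ℝ) (n : ℕ) :
    ∀ j < n + 1, ∀ t : ℝ, HasDerivAt
      (if j ≤ n then fun s : ℝ => c * ((s - a) ^ (n - j) / (n - j).factorial) else fun _ => 0)
      ((if j + 1 ≤ n then fun s : ℝ => c * ((s - a) ^ (n - (j + 1)) / (n - (j + 1)).factorial)
        else fun _ => 0) t) t := by
  intro j hj t
  rw [if_pos (by omega)]
  split_ifs with h1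
  · have h2 := (hasDerivAt_sub_pow_div_factorial a t (n - (j + 1))).const_mul c
    rwa [show n - (j + 1) + 1 = n - j by omega] at h2
  · rw [show n - j = 0 by omega]
    simpa using hasDerivAt_const t c

theorem hasDerivAt_solution_chain {h : ℝ → ℝ} (hc : ContinuousOn h (Ioo a b))
    (hh : IntegrableOn h (Ioo a b)) (r c : ℝ) (n : ℕ) :
    ∀ j < n + 1, ∀ t ∈ Ioo a b, HasDerivAt
      (fun s => r * ((if j ≤ n then fun s : ℝ => c * ((s - a) ^ (n - j) / (n - j).factorial)
        else fun _ => 0) s - integralChain a h (n + 1) j s))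
      (r * ((if j + 1 ≤ n then
        fun s : ℝ => c * ((s - a) ^ (n - (j + 1)) / (n - (j + 1)).factorial)
        else fun _ => 0) t - integralChain a h (n + 1) (j + 1) t)) t := fun j hj t ht =>
  ((hasDerivAt_chain c a n j hj t).sub
    (hasDerivAt_integralChain hc hh (n + 1) j hj t ht)).const_mul r

/-- The derivatives of `conv a B y` for a solution `y` of the integral equation. -/
theorem derivative_solution (H : IsInversePair (b - a) κ n A B) {h y : ℝ → ℝ}
    (hc : ContinuousOn h (Ioo a b)) (hh : IntegrableOn h (Ioo a b)) {c : ℝ}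
    (hy : ∀ t ∈ Icc a b, y t = c * A (t - a) - conv a A h t) :
    (∀ j < n + 1, DifferentiableOn ℝ (iteratedDeriv j (conv a B y)) (Ioo a b)) ∧
      ∀ t ∈ Ioo a b, iteratedDeriv (n + 1) (fun s => κ * conv a B y s) t + h t = 0 := by
  have h0 : ∀ t ∈ Ioo a b, conv a B y t =
      κ⁻¹ * (c * ((t - a) ^ n / n.factorial) - repeatedIntegral a h n t) := by
    intro t ht
    rw [← H.conv_solution hh c ht]
    exact conv_congr ht.1.le (fun _ _ => rfl)
      fun u hu => hy u ⟨hu.1.le, (hu.2.trans ht.2).le⟩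
  constructor
  · refine differentiableOn_iteratedDeriv_of_hasDerivAt isOpen_Ioo (fun t ht => ?_)
      (hasDerivAt_solution_chain hc hh κ⁻¹ c n)
    simp [integralChain, h0 t ht]
  · intro t ht
    have h1 := iteratedDeriv_eqOn_of_hasDerivAt isOpen_Ioo
      (F := fun s => κ * conv a B y s) (fun t ht => ?_)
      (hasDerivAt_solution_chain hc hh 1 c n) (n + 1) le_rfl ht
    · rw [h1]
      simp [integralChain]
    · simp [integralChain, h0 t ht, H.ne_zero]

/-- Every solution of the differential equation that vanishes at `a` solves the integral
equation. -/
theorem exists_eq_solution (H : IsInversePair (b - a) κ (n + 1) A B) (hab : a < b) {ν C : ℝ}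
    (hC : 0 < C) (hν : 0 < ν) (hn : (n : ℝ) ≤ ν)
    (hB : ∀ s ∈ Ioo 0 (b - a), |B s| ≤ C * s ^ (ν - 1)) {h y : ℝ → ℝ}
    (hc : ContinuousOn h (Ioo a b)) (hh : IntegrableOn h (Ioo a b))
    (hy : ContinuousOn y (Icc a b)) (hya : y a = 0)
    (hd : ∀ j < n + 1 + 1, DifferentiableOn ℝ (iteratedDeriv j (conv a B y)) (Ioo a b))
    (heq : ∀ t ∈ Ioo a b, iteratedDeriv (n + 1 + 1) (fun s => κ * conv a B y s) t + h t = 0) :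
    ∃ c, ∀ t ∈ Icc a b, y t = c * A (t - a) - conv a A h t := by
  have hF : ∀ j < n + 1 + 1, ∀ t ∈ Ioo a b, HasDerivAt
      (fun s => κ * iteratedDeriv j (conv a B y) s)
      (κ * iteratedDeriv (j + 1) (conv a B y) t) t := by
    intro j hj t ht
    rw [iteratedDeriv_succ]
    exact ((hd j hj).differentiableAt (isOpen_Ioo.mem_nhds ht)).hasDerivAt.const_mul κ
  have hF2 := iteratedDeriv_eqOn_of_hasDerivAt isOpen_Ioo (F := fun s => κ * conv a B y s)
    (f := fun j s => κ * iteratedDeriv j (conv a B y) s) (fun t _ => by simp) hF _ le_rfl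
  -- The chain starts at `κ B * y` plus the repeated integral of `h` and ends at the left side of
  -- the differential equation, which is zero.
  obtain ⟨c, hsum⟩ := exists_sum_of_hasDerivAt_chain (n + 1 + 1)
    (D := fun j s => κ * iteratedDeriv j (conv a B y) s + integralChain a h (n + 1 + 1) j s)
    (fun j hj t ht => (hF j hj t ht).add (hasDerivAt_integralChain hc hh _ j hj t ht))
    (fun t ht => by
      have h1 := heq t ht
      rw [hF2 ht] at h1
      simpa [integralChain] using h1)
  simp only [integralChain, iteratedDeriv_zero, Nat.succ_pos, if_true, Nat.add_sub_cancel,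
    Nat.sub_zero] at hsum
  have hlit : (fun t => κ * conv a B y t + repeatedIntegral a h (n + 1) t) =o[𝓝[>] a]
      fun t => (t - a) ^ n :=
    ((isLittleO_conv hab hC hν hn hB hy hya).const_mul_left κ).add
      (isLittleO_repeatedIntegral hab hh n)
  -- The top monomial, of degree `n + 1`, is itself `o(s ^ n)`; once it is removed, the remaining
  -- polynomial of degree at most `n` is `o(s ^ n)` and so vanishes.
  have hc0 : ∀ i ≤ n, c i / i.factorial = 0 := by
    refine coeff_eq_zero_of_isLittleO n (c := fun i => c i / i.factorial) ?_
    have hmap : Tendsto (fun s => a + s) (𝓝[>] 0) (𝓝[>] a) := by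
      refine tendsto_nhdsWithin_iff.2 ⟨?_, ?_⟩
      · have : Tendsto (fun s => a + s) (𝓝 0) (𝓝 (a + 0)) := (continuous_const_add a).tendsto 0
        rw [add_zero] at this
        exact this.mono_left nhdsWithin_le_nhds
      · filter_upwards [self_mem_nhdsWithin] with s hs
        simpa using hs
    have h1 := hlit.comp_tendsto hmap
    have h2 : (fun s : ℝ => c (n + 1) * (s ^ (n + 1) / (n + 1).factorial)) =o[𝓝[>] 0]
        fun s => s ^ n := by
      have h3 : (fun s : ℝ => s ^ (n + 1)) =o[𝓝[>] 0] fun s => s ^ n :=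
        (isLittleO_pow_pow (Nat.lt_succ_self n)).mono nhdsWithin_le_nhds
      refine (h3.const_mul_left (c (n + 1) / (n + 1).factorial)).congr_left fun s => ?_
      ring
    refine ((h1.congr_right fun s => ?_).sub h2).congr' ?_ EventuallyEq.rfl
    · simp
    · filter_upwards [Ioo_mem_nhdsGT (sub_pos.2 hab)] with s hs
      have h4 := hsum (a + s) ⟨by linarith [hs.1], by linarith [hs.2]⟩
      simp only [Function.comp]
      rw [h4, Finset.sum_range_succ, add_sub_cancel_left, add_sub_cancel_right]
      exact Finset.sum_congr rfl fun i _ => by ring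
  have htop : ∀ t ∈ Ioo a b, κ * conv a B y t =
      c (n + 1) * ((t - a) ^ (n + 1) / (n + 1).factorial) - repeatedIntegral a h (n + 1) t := by
    intro t ht
    have h1 := hsum t ht
    rw [Finset.sum_range_succ, Finset.sum_eq_zero, zero_add] at h1
    · linarith
    · intro i hi
      have h2 := hc0 i (by simpa [Nat.lt_succ_iff] using hi)
      rw [mul_div_left_comm, h2, mul_zero]
  refine ⟨c (n + 1), fun t ht => ?_⟩
  -- The surviving coefficient is the constant sought: with it, `y` and the candidate have the same
  -- convolution with `B`.
  have hz := H.continuousOn_solution hh (c (n + 1))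
  have h0 := H.eq_zero_of_conv_eq_zero hab (hy.sub hz) (fun s hs => ?_) t ht
  · exact sub_eq_zero.1 h0
  · refine (conv_sub (Ioo_subset_Icc_self hs) H.integrable hy hz).trans ?_
    rw [H.conv_solution hh _ hs, ← htop s hs, inv_mul_cancel_left₀ H.ne_zero, sub_self]

end IsInversePair

/-! ### The kernels of the boundary value problem -/

theorem continuous_prabhakarKernel {k ρ δ : ℝ} (hk : 0 < k) (hρ : 0 < ρ) (hδ : 0 < δ) (hkδ : k ≤ δ)
    (ω x : ℝ) : Continuous (prabhakarKernel k ρ ω δ x) := by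
  have h1 : 0 ≤ δ / k - 1 := sub_nonneg.2 ((one_le_div hk).2 hkδ)
  have h2 : 0 ≤ ρ / k := by positivity
  have h3 := continuous_kMittagLeffler hk hρ hδ x
  have h4 : Continuous fun s : ℝ => s ^ (δ / k - 1) :=
    continuous_id.rpow_const fun _ => Or.inr h1
  have h5 : Continuous fun s : ℝ => s ^ (ρ / k) := continuous_id.rpow_const fun _ => Or.inr h2
  unfold prabhakarKernel
  fun_prop

theorem prabhakarKernel_apply_zero {k δ : ℝ} (hk : 0 < k) (hkδ : k < δ) (ρ ω x : ℝ) :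
    prabhakarKernel k ρ ω δ x 0 = 0 := by
  have : δ / k - 1 ≠ 0 := (sub_pos.2 ((one_lt_div hk).2 hkδ)).ne'
  simp [prabhakarKernel, Real.zero_rpow this]

theorem prabhakarKernel_pos {k ρ δ ω x s : ℝ} (hk : 0 < k) (hρ : 0 < ρ) (hδ : 0 < δ)
    (hω : 0 < ω) (hx : 0 < x) (hs : 0 < s) : 0 < prabhakarKernel k ρ ω δ x s := by
  have := kMittagLeffler_pos hk hρ hδ hx (show 0 < ω * s ^ (ρ / k) by positivity)
  unfold prabhakarKernel
  positivity

theorem exists_abs_prabhakarKernel_le {k ρ δ : ℝ} (hk : 0 < k) (hρ : 0 < ρ) (hδ : 0 < δ)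
    (ω x T : ℝ) :
    ∃ C > 0, ∀ s ∈ Ioo 0 T, |prabhakarKernel k ρ ω δ x s| ≤ C * s ^ (δ / k - 1) := by
  have hE : Continuous fun s : ℝ => kMittagLeffler k ρ δ x (ω * s ^ (ρ / k)) :=
    (continuous_kMittagLeffler hk hρ hδ x).comp
      (continuous_const.mul (continuous_id.rpow_const fun _ => Or.inr (by positivity)))
  obtain ⟨C, hC⟩ := (isCompact_Icc (a := (0 : ℝ)) (b := T)).exists_bound_of_continuousOn
    hE.continuousOn
  refine ⟨(|C| + 1) / k, by positivity, fun s hs => ?_⟩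
  have h1 := hC s (Ioo_subset_Icc_self hs)
  rw [Real.norm_eq_abs] at h1
  have h2 : 0 ≤ s ^ (δ / k - 1) := Real.rpow_nonneg hs.1.le _
  rw [prabhakarKernel, abs_mul, abs_of_nonneg (by positivity)]
  calc _ ≤ s ^ (δ / k - 1) / k * (|C| + 1) := by
        gcongr
        linarith [le_abs_self C]
    _ = _ := by ring

theorem integrableOn_prabhakarKernel {k ρ δ : ℝ} (hk : 0 < k) (hρ : 0 < ρ) (hδ : 0 < δ)
    (ω x : ℝ) {T : ℝ} (hT : 0 < T) : IntegrableOn (prabhakarKernel k ρ ω δ x) (Ioo 0 T) := by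
  have hE : Continuous fun s : ℝ => kMittagLeffler k ρ δ x (ω * s ^ (ρ / k)) :=
    (continuous_kMittagLeffler hk hρ hδ x).comp
      (continuous_const.mul (continuous_id.rpow_const fun _ => Or.inr (by positivity)))
  have hδk : 0 < δ / k := by positivity
  have h1 : IntervalIntegrable (fun s : ℝ => s ^ (δ / k - 1) / k) volume 0 T :=
    (intervalIntegral.intervalIntegrable_rpow' (by linarith)).div_const k
  exact (intervalIntegrable_iff_integrableOn_Ioo_of_le hT.le).1
    (h1.mul_continuousOn hE.continuousOn)

/-- By the semigroup property the orders add up to `(n + 1) k` and the parameters `γ` and `-γ`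
cancel, leaving a power kernel. Its constant is the inverse of the factor `k ^ (n + 1)` in the
definition of the derivative. -/
theorem isInversePair_prabhakarKernel {k ρ β T : ℝ} (hk : 0 < k) (hρ : 0 < ρ) (hβ : 0 < β)
    (hkβ : k < β) (ω γ : ℝ) {n : ℕ} (hn : β < ((n + 1 : ℕ) : ℝ) * k) (hT : 0 < T) :
    IsInversePair T (k ^ (n + 1)) n (prabhakarKernel k ρ ω β γ)
      (prabhakarKernel k ρ ω (((n + 1 : ℕ) : ℝ) * k - β) (-γ)) := by
  have hδ := sub_pos.2 hn
  have hp : ∀ s : ℝ, powKernel k (((n + 1 : ℕ) : ℝ) * k) s =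
      (k ^ (n + 1))⁻¹ * (s ^ n / n.factorial) := by
    intro s
    rw [powKernel_natCast_succ_mul hk]
    field_simp
  refine ⟨by positivity, continuous_prabhakarKernel hk hρ hβ hkβ.le ω γ,
    prabhakarKernel_apply_zero hk hkβ ρ ω γ, integrableOn_prabhakarKernel hk hρ hδ ω (-γ) hT,
    fun s hs => ?_, fun s hs => ?_⟩
  · rw [conv_prabhakarKernel hk hρ hβ hδ ω γ (-γ) hs.1, add_neg_cancel, add_sub_cancel,
      prabhakarKernel_zero hk hρ (by positivity) ω hs.1, hp]
  · rw [conv_prabhakarKernel hk hρ hδ hβ ω (-γ) γ hs.1, neg_add_cancel, sub_add_cancel,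
      prabhakarKernel_zero hk hρ (by positivity) ω hs.1, hp]

/-! ### Green's function -/

theorem integral_green {k ρ β ω γ a b : ℝ} (hk : 0 < k) (hρ : 0 < ρ) (hkβ : k ≤ β)
    {q y : ℝ → ℝ} (hh : IntegrableOn (fun u => q u * y u) (Ioo a b)) {t : ℝ} (ht : t ∈ Icc a b) :
    ∫ u in a..b, green k ρ β ω γ a b t u * q u * y u =
      conv a (prabhakarKernel k ρ ω β γ) (fun u => q u * y u) b /
        prabhakarKernel k ρ ω β γ (b - a) * prabhakarKernel k ρ ω β γ (t - a) -
      conv a (prabhakarKernel k ρ ω β γ) (fun u => q u * y u) t := by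
  set A := prabhakarKernel k ρ ω β γ with hA
  set h : ℝ → ℝ := fun u => q u * y u with hh'
  have hAc : Continuous A := continuous_prabhakarKernel hk hρ (hk.trans_le hkβ) hkβ ω γ
  have hb := intervalIntegrable_conv_of_continuous (right_mem_Icc.2 (ht.1.trans ht.2)) hAc hh
  have htI := intervalIntegrable_conv_of_continuous ht hAc hh
  have hratio : (t - a) ^ (β / k - 1) * kMittagLeffler k ρ β γ (ω * (t - a) ^ (ρ / k)) /
      ((b - a) ^ (β / k - 1) * kMittagLeffler k ρ β γ (ω * (b - a) ^ (ρ / k))) =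
        A (t - a) / A (b - a) := by
    simp only [hA, prabhakarKernel, div_mul_eq_mul_div, div_div_div_cancel_right₀ hk.ne']
  have h1 : EqOn (fun u => green k ρ β ω γ a b t u * q u * y u)
      (fun u => A (t - a) / A (b - a) * (A (b - u) * h u) - A (t - u) * h u) (uIoc a t) := by
    intro u hu
    rw [uIoc_of_le ht.1] at hu
    simp only [green, if_pos hu.2, hratio]
    simp only [hA, hh', prabhakarKernel]
    ring
  have h2 : EqOn (fun u => green k ρ β ω γ a b t u * q u * y u)
      (fun u => A (t - a) / A (b - a) * (A (b - u) * h u)) (uIoc t b) := by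
    intro u hu
    rw [uIoc_of_le ht.2] at hu
    simp only [green, if_neg hu.1.not_ge, hratio]
    simp only [hA, hh', prabhakarKernel]
    ring
  have hmem : t ∈ uIcc a b := by rwa [uIcc_of_le (ht.1.trans ht.2)]
  have hb1 := (hb.mono_set (uIcc_subset_uIcc_left hmem)).const_mul (A (t - a) / A (b - a))
  have hb2 := (hb.mono_set (uIcc_subset_uIcc_right hmem)).const_mul (A (t - a) / A (b - a))
  rw [← intervalIntegral.integral_add_adjacent_intervals
    ((hb1.sub htI).congr h1.symm) (hb2.congr h2.symm),
    intervalIntegral.integral_congr_ae (ae_of_all _ fun u hu => h1 hu),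
    intervalIntegral.integral_congr_ae (ae_of_all _ fun u hu => h2 hu),
    intervalIntegral.integral_sub hb1 htI, sub_add_eq_add_sub,
    intervalIntegral.integral_add_adjacent_intervals hb1 hb2,
    intervalIntegral.integral_const_mul]
  simp only [conv]
  ring

/-- A solution of the boundary value problem is a solution of the integral equation, and
conversely, in terms of convolutions. -/
theorem isBVPSolution_iff {k ρ β ω γ a b : ℝ} (hab : a < b) (hk : 0 < k) (hkβ₁ : k < β)
    (hkβ₂ : β ≤ 2 * k) (hγ : 0 < γ) (hρ : 0 < ρ) (hω : 0 < ω)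
    {q y : ℝ → ℝ} (hqc : ContinuousOn q (Ioo a b)) (hy : ContinuousOn y (Icc a b))
    (hh : IntegrableOn (fun u => q u * y u) (Ioo a b)) :
    IsBVPSolution k ρ β ω γ a b q y ↔ ∀ t ∈ Icc a b,
      y t = conv a (prabhakarKernel k ρ ω β γ) (fun u => q u * y u) b /
        prabhakarKernel k ρ ω β γ (b - a) * prabhakarKernel k ρ ω β γ (t - a) -
      conv a (prabhakarKernel k ρ ω β γ) (fun u => q u * y u) t := by
  have hβ : 0 < β := hk.trans hkβ₁
  have hT : 0 < b - a := sub_pos.2 hab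
  have hhc : ContinuousOn (fun u => q u * y u) (Ioo a b) := hqc.mul (hy.mono Ioo_subset_Icc_self)
  -- The number of differentiations is `n + 2`: two if `β < 2k`, but three if `β = 2k`. Keeping `n`
  -- general treats both cases at once.
  obtain ⟨n, hn⟩ : ∃ n : ℕ, ⌊β / k⌋₊ = n + 1 :=
    Nat.exists_eq_succ_of_ne_zero (Nat.floor_pos.2 ((one_le_div hk).2 hkβ₁.le)).ne'
  have hlt : β < ((n + 1 + 1 : ℕ) : ℝ) * k := by
    have := Nat.lt_floor_add_one (β / k)
    rw [hn, div_lt_iff₀ hk] at this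
    exact_mod_cast this
  have hord : kOrder k β = n + 1 + 1 := by rw [kOrder, hn]
  have H := isInversePair_prabhakarKernel hk hρ hβ hkβ₁ ω γ hlt hT
  have hprim : kPrabhakarPrimitive k ρ β ω γ a y =
      conv a (prabhakarKernel k ρ ω (((n + 1 + 1 : ℕ) : ℝ) * k - β) (-γ)) y := by
    rw [kPrabhakarPrimitive, kPrabhakarIntegral_eq_conv, hord]
  have hAT : prabhakarKernel k ρ ω β γ (b - a) ≠ 0 := (prabhakarKernel_pos hk hρ hβ hω hγ hT).ne'
  constructor
  · intro hs
    have hδ := sub_pos.2 hlt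
    obtain ⟨C, hC, hB⟩ := exists_abs_prabhakarKernel_le hk hρ hδ ω (-γ) (b - a)
    -- Equivalent to `β ≤ 2k`: the singularity of `B` is then mild enough for `y a = 0` to remove
    -- every coefficient but the top one.
    have hν : (n : ℝ) ≤ (((n + 1 + 1 : ℕ) : ℝ) * k - β) / k := by
      rw [le_div_iff₀ hk]
      push_cast
      linarith
    have hd := hs.differentiable
    have he := hs.equation
    simp only [KPrabhakarDifferentiableOn, kPrabhakarDeriv, hord, hprim] at hd he
    obtain ⟨c, hc⟩ := H.exists_eq_solution hab hC (div_pos hδ hk) hν hB hhc hh hy hs.left hd he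
    have hcb : c = conv a (prabhakarKernel k ρ ω β γ) (fun u => q u * y u) b /
        prabhakarKernel k ρ ω β γ (b - a) := by
      have := hc b (right_mem_Icc.2 hab.le)
      rw [hs.right] at this
      rw [eq_div_iff hAT]
      linarith
    intro t ht
    rw [← hcb]
    exact hc t ht
  · intro hs
    obtain ⟨h1, h2⟩ := H.derivative_solution hhc hh hs
    refine ⟨?_, ?_, ?_, ?_⟩
    · rw [KPrabhakarDifferentiableOn, hord, hprim]
      exact h1
    · simp only [kPrabhakarDeriv, hord, hprim]
      exact h2
    · rw [hs a (left_mem_Icc.2 hab.le), sub_self, H.apply_zero]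
      simp [conv]
    · rw [hs b (right_mem_Icc.2 hab.le), div_mul_cancel₀ _ hAT, sub_self]

end KPrabhakar
end

theorem theorem1 (k ρ β ω γ a b : ℝ) (hab : a < b)
    (hk : 0 < k) (hβ₁ : 1 < β) (hβ₂ : β ≤ 2) (hkβ₁ : k < β) (hkβ₂ : β ≤ 2 * k)
    (hγ : 0 < γ) (hρ : 0 < ρ) (hω : 0 < ω)
    (q : ℝ → ℝ) (hqc : ContinuousOn q (Ioo a b)) (hqi : IntegrableOn q (Ioo a b))
    (y : ℝ → ℝ) (hy : ContinuousOn y (Icc a b)) :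
    KPrabhakar.IsBVPSolution k ρ β ω γ a b q y ↔
      ∀ t ∈ Icc a b, y t = ∫ u in a..b, KPrabhakar.green k ρ β ω γ a b t u * q u * y u := by
  have hh : IntegrableOn (fun u => q u * y u) (Ioo a b) := by
    rw [← integrableOn_Icc_iff_integrableOn_Ioo] at hqi ⊢
    exact hqi.mul_continuousOn hy isCompact_Icc
  rw [KPrabhakar.isBVPSolution_iff hab hk hkβ₁ hkβ₂ hγ hρ hω hqc hy hh]
  exact forall₂_congr fun t ht => by rw [KPrabhakar.integral_green hk hρ hkβ₁.le hh ht]
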